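/- Let $a_1,a_2,a_3$ be pairwise coprime positive integers, and let $b,b_1,b_2,b_3$ be any integers with $a_1a_2a_3\left(b+\frac{b_1}{a_1}+\frac{b_2}{a_2}+\frac{b_3}{a_3}\right)=1$. For integers $\beta,\beta_1,\beta_2,\beta_3$ put $$G(\beta;\beta_1,\beta_2,\beta_3)=\langle x,y,z,h\mid h\text{ central},\ x^{a_1}=h^{-\beta_1},\ y^{a_2}=h^{-\beta_2},\ z^{a_3}=h^{-\beta_3},\ xyz=h^{\beta}\rangle ,$$ the fundamental group, in its standard presentation, of the Seifert fibered space $M(0;(1,\beta),(a_1,\beta_1),(a_2,\beta_2),(a_3,\beta_3))$ with regular fiber $h$. It projects onto the orbifold group $\Gamma=\Gamma(a_1,a_2,a_3)=\langle x,y,z\mid x^{a_1}=y^{a_2}=z^{a_3}=xyz=1\rangle$ by $h\mapsto 1$. The fundamental group of the Brieskorn homology sphere $\Sigma(a_1,a_2,a_3)$ is taken in its Seifert presentation $\pi_1\Sigma(a_1,a_2,a_3)=G(b;b_1,b_2,b_3)$. *Euler classes.* Euler classes of central extensions of $\Gamma$ by $\mathbb Z$ are written as elements of the abelian group $\langle x_0,x_1,x_2,x_3\mid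 a_ix_i=x_0\ (i=1,2,3)\rangle$. Let $E$ be the set of classes $-x_0+\beta_1x_1+\beta_2x_2+\beta_3x_3$ with $\beta_i\in\mathbb Z$, $0<\beta_i<a_i$ and $\sum_i\beta_i/a_i<1$. *The group $\widetilde{PSL}(2;\mathbb R)$.* The universal cover $\widetilde{PSL}(2;\mathbb R)$ of $PSL(2;\mathbb R)$ is realized as the group of homeomorphisms of $\mathbb R$ lifting the projective transformations of $\mathbb RP^1=\mathbb R/\mathbb Z$ given by $PSL(2;\mathbb R)$, where $t\in\mathbb R$ covers the line through $(\cos\pi t,\sin\pi t)$. The translation $\mathrm{sh}(1)\colon t\mapsto t+1$ generates its center, and $\widetilde{PSL}(2;\mathbb R)$ projects onto $SL(2;\mathbb R)$ with kernel $\langle\mathrm{sh}(2)\rangle$. *Induced representations.* A homomorphism $f\colon\Gamma\to PSL(2;\mathbb R)$ has Euler class $eu=\beta x_0+\beta_1x_1+\beta_2x_2+\beta_3x_3$ if the pull-back under $f$ of the central extension $0\to\mathbb Z\to\widetilde{PSL}(2;\mathbb R)\to PSL(2;\mathbb R)\to 1$ is isomorphic to $G(\beta;\beta_1,\beta_2,\beta_3)$,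 by an isomorphism over $\Gamma$ under which $h$ corresponds to $(1,\mathrm{sh}(1))$. Composing $G(\beta;\beta_1,\beta_2,\beta_3)\to\widetilde{PSL}(2;\mathbb R)\to SL(2;\mathbb R)$ gives a representation $\overline\rho$ of $\pi_1\overline M=G(\beta;\beta_1,\beta_2,\beta_3)$. Let $p\colon\pi_1\Sigma(a_1,a_2,a_3)\to\pi_1\overline M$ be the homomorphism induced by the universal abelian covering of Seifert fibered spaces over the identity of the base orbifold; that is, $p$ is injective, its image is the commutator subgroup, and it commutes with the projections to $\Gamma$. The representation $\rho_{eu}=\overline\rho\circ p\colon\pi_1\Sigma(a_1,a_2,a_3)\to SL(2;\mathbb R)$ is called induced by $eu$. **Theorem.** For every $eu\in E$ an induced representation $\rho_{eu}$ exists, and it is unique up to conjugation by $SL(2;\mathbb C)$. Let $\rho\colon\pi_1\Sigma(a_1,a_2,a_3)\to SL(2;\mathbb C)$ be an irreducible representation which is not conjugate in $SL(2;\mathbb C)$ to an $SU(2)$-representation. Then there is a unique $eu\in E$ such that $\rho_{eu}$ is conjugate to $\rho$ by an element of $SL(2;\mathbb C)$. -/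

import Mathlib

namespace Brieskorn

/-! ### Fundamental groups of Seifert fibered spaces and of the base orbifold -/

/-- Generators of the fundamental group of a Seifert fibered space over the sphere with three
singular fibers; `h` is the class of the regular fiber. -/
inductive SeifertGen
  | x | y | z | h

/-- The relators saying that `h` is central, `x ^ a₁ = h ^ (-b₁)`, `y ^ a₂ = h ^ (-b₂)`,
`z ^ a₃ = h ^ (-b₃)` and `x * y * z = h ^ b`. Here `b₀` is the integer `b`, and the indices
`1, 2, 3` are written `0, 1, 2`. -/
def seifertRels (a : Fin 3 → ℕ) (b₀ : ℤ) (b : Fin 3 → ℤ) : Set (FreeGroup SeifertGen) :=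
  let x := FreeGroup.of SeifertGen.x
  let y := FreeGroup.of SeifertGen.y
  let z := FreeGroup.of SeifertGen.z
  let h := FreeGroup.of SeifertGen.h
  {x * h * x⁻¹ * h⁻¹, y * h * y⁻¹ * h⁻¹, z * h * z⁻¹ * h⁻¹,
    x ^ a 0 * h ^ b 0, y ^ a 1 * h ^ b 1, z ^ a 2 * h ^ b 2,
    x * y * z * (h ^ b₀)⁻¹}

/-- The fundamental group of the Seifert fibered space
`M(0; (1, b₀), (a₁, b₁), (a₂, b₂), (a₃, b₃))`, given by its standard presentation. -/
abbrev SeifertGroup (a : Fin 3 → ℕ) (b₀ : ℤ) (b : Fin 3 → ℤ) : Type :=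
  PresentedGroup (seifertRels a b₀ b)

/-- The class of the regular fiber. -/
def fiber (a : Fin 3 → ℕ) (b₀ : ℤ) (b : Fin 3 → ℤ) : SeifertGroup a b₀ b :=
  PresentedGroup.of SeifertGen.h

/-- Generators of the orbifold fundamental group of `S²(a₁, a₂, a₃)`. -/
inductive OrbifoldGen
  | x | y | z

/-- The relators `x ^ a₁`, `y ^ a₂`, `z ^ a₃`, `x * y * z`. -/
def orbifoldRels (a : Fin 3 → ℕ) : Set (FreeGroup OrbifoldGen) :=
  let x := FreeGroup.of OrbifoldGen.x
  let y := FreeGroup.of OrbifoldGen.y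
  let z := FreeGroup.of OrbifoldGen.z
  {x ^ a 0, y ^ a 1, z ^ a 2, x * y * z}

/-- The orbifold fundamental group `Γ(a₁, a₂, a₃)` of `S²(a₁, a₂, a₃)`. -/
abbrev OrbifoldGroup (a : Fin 3 → ℕ) : Type := PresentedGroup (orbifoldRels a)

/-- The images of the generators under the projection to the base orbifold. -/
def toOrbifoldGen (a : Fin 3 → ℕ) : SeifertGen → OrbifoldGroup a
  | .x => PresentedGroup.of .x
  | .y => PresentedGroup.of .y
  | .z => PresentedGroup.of .z
  | .h => 1

theorem toOrbifoldGen_rels (a : Fin 3 → ℕ) (b₀ : ℤ) (b : Fin 3 → ℤ) :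
    ∀ r ∈ seifertRels a b₀ b, FreeGroup.lift (toOrbifoldGen a) r = 1 := by
  have hx : (PresentedGroup.of .x : OrbifoldGroup a) ^ a 0 = 1 :=
    (map_pow _ _ _).symm.trans (PresentedGroup.one_of_mem (rels := orbifoldRels a)
      (x := FreeGroup.of .x ^ a 0) (by simp [orbifoldRels]))
  have hy : (PresentedGroup.of .y : OrbifoldGroup a) ^ a 1 = 1 :=
    (map_pow _ _ _).symm.trans (PresentedGroup.one_of_mem (rels := orbifoldRels a)
      (x := FreeGroup.of .y ^ a 1) (by simp [orbifoldRels]))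
  have hz : (PresentedGroup.of .z : OrbifoldGroup a) ^ a 2 = 1 :=
    (map_pow _ _ _).symm.trans (PresentedGroup.one_of_mem (rels := orbifoldRels a)
      (x := FreeGroup.of .z ^ a 2) (by simp [orbifoldRels]))
  have hxyz : (PresentedGroup.of .x : OrbifoldGroup a) * PresentedGroup.of .y *
      PresentedGroup.of .z = 1 :=
    PresentedGroup.one_of_mem (rels := orbifoldRels a)
      (x := FreeGroup.of .x * FreeGroup.of .y * FreeGroup.of .z) (by simp [orbifoldRels])
  intro r hr
  simp only [seifertRels, Set.mem_insert_iff, Set.mem_singleton_iff] at hr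
  rcases hr with rfl | rfl | rfl | rfl | rfl | rfl | rfl <;>
    simp [toOrbifoldGen, hx, hy, hz, hxyz]

/-- The projection onto the orbifold fundamental group of the base; it kills the fiber. -/
def toOrbifold (a : Fin 3 → ℕ) (b₀ : ℤ) (b : Fin 3 → ℤ) :
    SeifertGroup a b₀ b →* OrbifoldGroup a :=
  PresentedGroup.toGroup (toOrbifoldGen_rels a b₀ b)

/-- `p` is the homomorphism induced on fundamental groups by the universal abelian covering
from the first Seifert fibered space onto the second, which preserves the fibers and induces
the identity on the base orbifold: `p` is injective, its image is the commutator subgroup, and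
it commutes with the projections to the orbifold group. -/
structure IsUniversalAbelianCover {a : Fin 3 → ℕ} {b₀ β₀ : ℤ} {b β : Fin 3 → ℤ}
    (p : SeifertGroup a b₀ b →* SeifertGroup a β₀ β) : Prop where
  injective : Function.Injective p
  range_eq : p.range = commutator (SeifertGroup a β₀ β)
  over_base : (toOrbifold a β₀ β).comp p = toOrbifold a b₀ b

/-! ### The universal cover of `PSL(2; ℝ)` -/

/-- The group `SL(2; ℝ)`. -/
abbrev SL2R : Type := Matrix.SpecialLinearGroup (Fin 2) ℝ

/-- The group `SL(2; ℂ)`. -/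
abbrev SL2C : Type := Matrix.SpecialLinearGroup (Fin 2) ℂ

/-- The group `PSL(2; ℝ)`, the quotient of `SL(2; ℝ)` by its center `{1, -1}`. -/
abbrev PSL2R : Type := Matrix.ProjectiveSpecialLinearGroup (Fin 2) ℝ

/-- The vector `(cos πt, sin πt)`. The map sending `t` to the line through this vector is the
universal covering of `ℝP¹` by `ℝ`, with deck group `ℤ`. -/
noncomputable def circleVec (t : ℝ) : Fin 2 → ℝ :=
  ![Real.cos (Real.pi * t), Real.sin (Real.pi * t)]

/-- `φ` is a lift of the action of `A` on rays from the origin of `ℝ²`. A homeomorphism `φ` of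
`ℝ` is a lift of the action of `±A` on `ℝP¹` if and only if this holds for `A` or for `-A`. -/
def IsLift (A : SL2R) (φ : ℝ ≃ₜ ℝ) : Prop :=
  ∀ t : ℝ, ∃ c : ℝ, 0 < c ∧ (A : Matrix (Fin 2) (Fin 2) ℝ).mulVec (circleVec t) =
    c • circleVec (φ t)

theorem IsLift.one : IsLift 1 1 := fun t => ⟨1, one_pos, by simp⟩

theorem IsLift.mul {A B : SL2R} {φ ψ : ℝ ≃ₜ ℝ} (hA : IsLift A φ) (hB : IsLift B ψ) :
    IsLift (A * B) (φ * ψ) := by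
  intro t
  obtain ⟨d, hd, hd'⟩ := hB t
  obtain ⟨c, hc, hc'⟩ := hA (ψ t)
  refine ⟨d * c, mul_pos hd hc, ?_⟩
  rw [Matrix.SpecialLinearGroup.coe_mul, ← Matrix.mulVec_mulVec, hd', Matrix.mulVec_smul, hc',
    smul_smul]
  rfl

theorem IsLift.inv {A : SL2R} {φ : ℝ ≃ₜ ℝ} (hA : IsLift A φ) : IsLift A⁻¹ φ⁻¹ := by
  intro t
  obtain ⟨c, hc, hc'⟩ := hA (φ⁻¹ t)
  have e : φ (φ⁻¹ t) = t := φ.apply_symm_apply t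
  rw [e] at hc'
  refine ⟨c⁻¹, inv_pos.2 hc, ?_⟩
  have h2 : circleVec t =
      c⁻¹ • (A : Matrix (Fin 2) (Fin 2) ℝ).mulVec (circleVec (φ⁻¹ t)) := by
    rw [hc', smul_smul, inv_mul_cancel₀ hc.ne', one_smul]
  rw [h2, Matrix.mulVec_smul, Matrix.mulVec_mulVec, ← Matrix.SpecialLinearGroup.coe_mul,
    inv_mul_cancel]
  simp

theorem IsLift.eq_one {C : SL2R} (h : IsLift C 1) : C = 1 := by
  have h0 := h 0
  have h1 := h (1 / 2)
  have h2 := h (1 / 4)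
  obtain ⟨c, hc, e0⟩ := h0
  obtain ⟨d, hd, e1⟩ := h1
  obtain ⟨k, hk, e2⟩ := h2
  have v0 : circleVec 0 = ![1, 0] := by simp [circleVec]
  have v1 : circleVec (1 / 2) = ![0, 1] := by
    have q : Real.pi * (1 / 2) = Real.pi / 2 := by ring
    simp only [circleVec, q, Real.cos_pi_div_two, Real.sin_pi_div_two]
  have v2 : circleVec (1 / 4) = ![√2 / 2, √2 / 2] := by
    have q : Real.pi * (1 / 4) = Real.pi / 4 := by ring
    simp only [circleVec, q, Real.cos_pi_div_four, Real.sin_pi_div_four]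
  have s2 : (0 : ℝ) < √2 := by positivity
  have hdet := C.det_coe
  rw [Matrix.det_fin_two] at hdet
  rw [Homeomorph.one_apply, v0] at e0
  rw [Homeomorph.one_apply, v1] at e1
  rw [Homeomorph.one_apply, v2] at e2
  have a0 := congrFun e0 0
  have a1 := congrFun e0 1
  have b0 := congrFun e1 0
  have b1 := congrFun e1 1
  have c0 := congrFun e2 0
  have c1 := congrFun e2 1
  simp [Matrix.mulVec, dotProduct, Fin.sum_univ_two] at a0 a1 b0 b1
  simp [Matrix.mulVec, dotProduct, Fin.sum_univ_two, a0, a1, b0, b1] at c0 c1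
  rw [a0, a1, b0, b1] at hdet
  have hcd : c = d := by rw [c0, c1]
  subst hcd
  have hc1 : c = 1 := by nlinarith
  ext i j
  fin_cases i <;> fin_cases j <;> simp [a0, a1, b0, b1, hc1]

theorem IsLift.unique {A B : SL2R} {φ : ℝ ≃ₜ ℝ} (hA : IsLift A φ) (hB : IsLift B φ) : A = B := by
  have h := hA.mul hB.inv
  rw [mul_inv_cancel] at h
  exact mul_inv_eq_one.1 h.eq_one

/-- The universal cover of `PSL(2; ℝ)`, as the group of all homeomorphisms of `ℝ` which lift
projective transformations of `ℝP¹` given by elements of `PSL(2; ℝ)`. -/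
def UnivPSL : Subgroup (ℝ ≃ₜ ℝ) where
  carrier := {φ | ∃ A : SL2R, IsLift A φ}
  one_mem' := ⟨1, IsLift.one⟩
  mul_mem' := fun ⟨A, hA⟩ ⟨B, hB⟩ => ⟨A * B, hA.mul hB⟩
  inv_mem' := fun ⟨A, hA⟩ => ⟨A⁻¹, hA.inv⟩

/-- The projection from the universal cover of `PSL(2; ℝ)` onto `SL(2; ℝ)`. -/
noncomputable def UnivPSL.toSL : UnivPSL →* SL2R where
  toFun φ := φ.2.choose
  map_one' := (Exists.choose_spec (1 : UnivPSL).2).unique IsLift.one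
  map_mul' φ ψ := (Exists.choose_spec (φ * ψ).2).unique (φ.2.choose_spec.mul ψ.2.choose_spec)

theorem UnivPSL.isLift_toSL (φ : UnivPSL) : IsLift (UnivPSL.toSL φ) φ := φ.2.choose_spec

/-- The covering projection onto `PSL(2; ℝ)`. -/
noncomputable def UnivPSL.toPSL : UnivPSL →* PSL2R :=
  (QuotientGroup.mk' (Subgroup.center SL2R)).comp UnivPSL.toSL

/-- The rotation matrix of angle `πr`. -/
noncomputable def rotation (r : ℝ) : SL2R :=
  ⟨!![Real.cos (Real.pi * r), -Real.sin (Real.pi * r);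
      Real.sin (Real.pi * r), Real.cos (Real.pi * r)], by
    rw [Matrix.det_fin_two_of]
    nlinarith [Real.sin_sq_add_cos_sq (Real.pi * r)]⟩

theorem isLift_rotation (r : ℝ) : IsLift (rotation r) (Homeomorph.addRight r) := by
  intro t
  refine ⟨1, one_pos, ?_⟩
  ext i
  fin_cases i
  · simp [rotation, circleVec, Matrix.mulVec, dotProduct, Fin.sum_univ_two, mul_add,
      Real.cos_add]
    ring
  · simp [rotation, circleVec, Matrix.mulVec, dotProduct, Fin.sum_univ_two, mul_add,
      Real.sin_add]
    ring

/-- The translation `t ↦ t + r` of `ℝ`, as an element of the universal cover. -/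
noncomputable def sh (r : ℝ) : UnivPSL := ⟨Homeomorph.addRight r, rotation r, isLift_rotation r⟩

/-! ### Euler classes -/

/-- The group `⟨x₀, x₁, x₂, x₃ | a₁ x₁ = x₀, a₂ x₂ = x₀, a₃ x₃ = x₀⟩` of Euler classes of central
extensions of `Γ(a₁, a₂, a₃)` by `ℤ`. The pair `(β, (β₁, β₂, β₃))` stands for
`β x₀ + β₁ x₁ + β₂ x₂ + β₃ x₃`. -/
abbrev EulerGroup (a : Fin 3 → ℕ) : Type :=
  (ℤ × (Fin 3 → ℤ)) ⧸ AddSubgroup.closure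
    (Set.range fun i : Fin 3 => ((-1 : ℤ), (Pi.single i (a i : ℤ) : Fin 3 → ℤ)))

/-- The element `β₀ x₀ + β₁ x₁ + β₂ x₂ + β₃ x₃`. -/
def eulerClass (a : Fin 3 → ℕ) (β₀ : ℤ) (β : Fin 3 → ℤ) : EulerGroup a :=
  QuotientAddGroup.mk (β₀, β)

/-- The set `E` of the Euler classes `-x₀ + β₁ x₁ + β₂ x₂ + β₃ x₃` with `0 < βᵢ < aᵢ` and
`β₁ / a₁ + β₂ / a₂ + β₃ / a₃ < 1`. -/
def eulerSet (a : Fin 3 → ℕ) : Set (EulerGroup a) :=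
  {eu | ∃ β : Fin 3 → ℤ, (∀ i, 0 < β i ∧ β i < (a i : ℤ)) ∧
    ∑ i, (β i : ℚ) / (a i : ℚ) < 1 ∧ eu = eulerClass a (-1) β}

/-- The pull-back along `f` of the central extension of `PSL(2; ℝ)` by its universal cover. -/
noncomputable def pullback {a : Fin 3 → ℕ} (f : OrbifoldGroup a →* PSL2R) :
    Subgroup (OrbifoldGroup a × UnivPSL) :=
  (f.comp (MonoidHom.fst (OrbifoldGroup a) UnivPSL)).eqLocus
    (UnivPSL.toPSL.comp (MonoidHom.snd (OrbifoldGroup a) UnivPSL))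

/-- The homomorphism from the pull-back extension to the universal cover of `PSL(2; ℝ)`. -/
noncomputable def pullbackSnd {a : Fin 3 → ℕ} (f : OrbifoldGroup a →* PSL2R) : pullback f →* UnivPSL :=
  (MonoidHom.snd (OrbifoldGroup a) UnivPSL).comp (pullback f).subtype

/-- An isomorphism of central extensions of `Γ(a₁, a₂, a₃)` by `ℤ` from the fundamental group of
the Seifert fibered space `M(0; (1, β₀), (a₁, β₁), (a₂, β₂), (a₃, β₃))` to the pull-back extension
along `f`. It is the identity on the quotient `Γ(a₁, a₂, a₃)` and maps the fiber to `sh 1`. -/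
structure EulerIso {a : Fin 3 → ℕ} (f : OrbifoldGroup a →* PSL2R) (β₀ : ℤ) (β : Fin 3 → ℤ) where
  toMulEquiv : SeifertGroup a β₀ β ≃* pullback f
  fst_apply : ∀ g, (toMulEquiv g : OrbifoldGroup a × UnivPSL).1 = toOrbifold a β₀ β g
  fiber_apply : (toMulEquiv (fiber a β₀ β) : OrbifoldGroup a × UnivPSL) = (1, sh 1)

/-- The resulting representation in `SL(2; ℝ)` of the fundamental group of
`M(0; (1, β₀), (a₁, β₁), (a₂, β₂), (a₃, β₃))`, obtained by projecting its image in the universal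
cover of `PSL(2; ℝ)` to `SL(2; ℝ)`. -/
noncomputable def EulerIso.rep {a : Fin 3 → ℕ} {f : OrbifoldGroup a →* PSL2R} {β₀ : ℤ}
    {β : Fin 3 → ℤ} (Ψ : EulerIso f β₀ β) : SeifertGroup a β₀ β →* SL2R :=
  UnivPSL.toSL.comp ((pullbackSnd f).comp Ψ.toMulEquiv.toMonoidHom)

/-- `σ` is an `SL(2; ℝ)`-representation induced by the Euler class `eu`. There are a
homomorphism `f` to `PSL(2; ℝ)` whose Euler class is `eu = β₀ x₀ + β₁ x₁ + β₂ x₂ + β₃ x₃`, and a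
universal abelian covering `p` of `M(0; (1, β₀), (a₁, β₁), (a₂, β₂), (a₃, β₃))`, such that `σ` is
the pull-back by `p` of the resulting representation. -/
def IsInducedRep {a : Fin 3 → ℕ} {b₀ : ℤ} {b : Fin 3 → ℤ} (eu : EulerGroup a)
    (σ : SeifertGroup a b₀ b →* SL2R) : Prop :=
  ∃ (β₀ : ℤ) (β : Fin 3 → ℤ) (f : OrbifoldGroup a →* PSL2R) (Ψ : EulerIso f β₀ β)
    (p : SeifertGroup a b₀ b →* SeifertGroup a β₀ β),
    eulerClass a β₀ β = eu ∧ IsUniversalAbelianCover p ∧ σ = Ψ.rep.comp p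

/-! ### Representations in `SL(2; ℂ)` -/

/-- The linear representation on `ℂ²` given by a homomorphism to `SL(2; ℂ)`. -/
noncomputable def linearRep {G : Type*} [Group G] (ρ : G →* SL2C) :
    Representation ℂ G (Fin 2 → ℂ) :=
  (LinearEquiv.automorphismGroup.toLinearMapMonoidHom (R := ℂ) (M := Fin 2 → ℂ)).comp
    (Matrix.SpecialLinearGroup.toLin'.comp ρ)

/-- A homomorphism to `SL(2; ℝ)` regarded as one to `SL(2; ℂ)`. -/
noncomputable def complexify {G : Type*} [Group G] (σ : G →* SL2R) : G →* SL2C :=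
  (Matrix.SpecialLinearGroup.map (algebraMap ℝ ℂ)).comp σ

/-- Conjugacy of representations by an element of `SL(2; ℂ)`. -/
def RepConj {G : Type*} [Group G] (ρ ρ' : G →* SL2C) : Prop :=
  ∃ P : SL2C, ∀ g, ρ' g = P * ρ g * P⁻¹

/-- The image of `ρ` lies in `SU(2)`. -/
def IsSU2Rep {G : Type*} [Group G] (ρ : G →* SL2C) : Prop :=
  ∀ g, (ρ g : Matrix (Fin 2) (Fin 2) ℂ) ∈ Matrix.specialUnitaryGroup (Fin 2) ℂ

end Brieskorn

/-! An induced representation is the same thing as a lift: for `eu` of nonzero rational Euler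
number, `σ` is induced by `eu` when `σ` is the projection of some `θ : π₁Σ → UnivPSL` sending the
fiber to `sh k`, where `k` is the degree `a₁a₂a₃(β + Σ βᵢ/aᵢ)` of `eu`, and the generators satisfy
integral congruences fixed by `eu` (`IsInducedRep.exists_lift`, `isInducedRep_of_lift`). The
homology sphere condition makes these congruences solvable (`exists_lift_coefficients`). For `eu ∈
E` the numbers `πβᵢ/aᵢ` are positive with sum less than `π`, so they are the angles of a hyperbolic
triangle; rotations about its vertices have a product which lifts to `sh (-1)` (`exists_triangle`),
and twisting them by integral translations gives `θ`.

Everything else is done with traces. A pair in `SL(2; ℂ)` without a common eigenvector is determined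
up to conjugacy by `tr X`, `tr Y`, `tr XY` (`exists_conj_of_trace_eq`), and `θ` has traces depending
only on `β`; hence `ρ_eu` is unique up to conjugacy.

Let `ρ` be irreducible. By Schur's lemma the fiber goes to `±1`, so `x`, `y`, `z` have finite order
and their traces are `2 cos` of rational multiples of `π`. The Fricke polynomial of the three traces
is then real and nonzero. If it is negative, an explicit pair in `SU(2)` has the same traces, and
`ρ` is conjugate into `SU(2)` (`exists_conj_specialUnitary`). If it is positive, it factors as
`4(cos(A+B)+cos C)(cos(A-B)+cos C)`, and replacing zero or two of the angles by their supplements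
gives a hyperbolic triangle (`triangle_cases_of_fricke_pos`), hence a class in `E` whose induced
representation has the same traces up to signs. Since `π₁Σ` is perfect, agreement of generators up
to central signs is agreement (`seifertGroup_hom_eq_of_center`). The class is unique because
flipping two angles of a hyperbolic triangle makes the angle sum exceed `π`
(`triangle_angles_unique`). -/

namespace Brieskorn

/-! ### Seifert groups -/

section SeifertGroup

/-- The generators `x`, `y`, `z`, indexed by the singular fibers. -/
def singular (a : Fin 3 → ℕ) (b₀ : ℤ) (b : Fin 3 → ℤ) : Fin 3 → SeifertGroup a b₀ b :=
  ![PresentedGroup.of .x, PresentedGroup.of .y, PresentedGroup.of .z]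

/-- The generators of the orbifold group, indexed by the cone points. -/
def cone (a : Fin 3 → ℕ) : Fin 3 → OrbifoldGroup a :=
  ![PresentedGroup.of .x, PresentedGroup.of .y, PresentedGroup.of .z]

variable {a : Fin 3 → ℕ} {b₀ : ℤ} {b : Fin 3 → ℤ}

theorem fiber_commute_singular (i : Fin 3) : Commute (fiber a b₀ b) (singular a b₀ b i) := by
  have hx := PresentedGroup.one_of_mem (rels := seifertRels a b₀ b)
    (x := FreeGroup.of .x * FreeGroup.of .h * (FreeGroup.of .x)⁻¹ * (FreeGroup.of .h)⁻¹)
    (by simp [seifertRels])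
  have hy := PresentedGroup.one_of_mem (rels := seifertRels a b₀ b)
    (x := FreeGroup.of .y * FreeGroup.of .h * (FreeGroup.of .y)⁻¹ * (FreeGroup.of .h)⁻¹)
    (by simp [seifertRels])
  have hz := PresentedGroup.one_of_mem (rels := seifertRels a b₀ b)
    (x := FreeGroup.of .z * FreeGroup.of .h * (FreeGroup.of .z)⁻¹ * (FreeGroup.of .h)⁻¹)
    (by simp [seifertRels])
  simp only [map_mul, map_inv] at hx hy hz
  rw [← commutatorElement_def, commutatorElement_eq_one_iff_commute] at hx hy hz
  fin_cases i
  exacts [hx.symm, hy.symm, hz.symm]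

theorem singular_pow (i : Fin 3) : singular a b₀ b i ^ a i = fiber a b₀ b ^ (-b i) := by
  have hx := PresentedGroup.one_of_mem (rels := seifertRels a b₀ b)
    (x := FreeGroup.of .x ^ a 0 * FreeGroup.of .h ^ b 0) (by simp [seifertRels])
  have hy := PresentedGroup.one_of_mem (rels := seifertRels a b₀ b)
    (x := FreeGroup.of .y ^ a 1 * FreeGroup.of .h ^ b 1) (by simp [seifertRels])
  have hz := PresentedGroup.one_of_mem (rels := seifertRels a b₀ b)
    (x := FreeGroup.of .z ^ a 2 * FreeGroup.of .h ^ b 2) (by simp [seifertRels])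
  simp only [map_mul, map_pow, map_zpow] at hx hy hz
  rw [zpow_neg]
  fin_cases i
  exacts [eq_inv_of_mul_eq_one_left hx, eq_inv_of_mul_eq_one_left hy,
    eq_inv_of_mul_eq_one_left hz]

theorem singular_prod :
    singular a b₀ b 0 * singular a b₀ b 1 * singular a b₀ b 2 = fiber a b₀ b ^ b₀ := by
  have h := PresentedGroup.one_of_mem (rels := seifertRels a b₀ b)
    (x := FreeGroup.of .x * FreeGroup.of .y * FreeGroup.of .z * (FreeGroup.of .h ^ b₀)⁻¹)
    (by simp [seifertRels])
  simp only [map_mul, map_inv, map_zpow] at h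
  exact mul_inv_eq_one.1 h

/-! ### Homomorphisms out of the presented groups, and the kernel of the projection. -/

theorem exists_seifertGroup_hom {H : Type*} [Group H] (u : Fin 3 → H) (t : H)
    (hc : ∀ i, Commute t (u i)) (hp : ∀ i, u i ^ a i = t ^ (-b i))
    (hm : u 0 * u 1 * u 2 = t ^ b₀) :
    ∃ φ : SeifertGroup a b₀ b →* H,
      φ (fiber a b₀ b) = t ∧ ∀ i, φ (singular a b₀ b i) = u i := by
  let g : SeifertGen → H := fun s => match s with
    | .x => u 0
    | .y => u 1
    | .z => u 2
    | .h => t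
  have hg : ∀ r ∈ seifertRels a b₀ b, FreeGroup.lift g r = 1 := by
    intro r hr
    simp only [seifertRels, Set.mem_insert_iff, Set.mem_singleton_iff] at hr
    have hc' : ∀ i, u i * t * (u i)⁻¹ * t⁻¹ = 1 := fun i => by
      rw [← commutatorElement_def, commutatorElement_eq_one_iff_commute]
      exact (hc i).symm
    rcases hr with rfl | rfl | rfl | rfl | rfl | rfl | rfl <;>
      simp [g, hc', hp, hm]
  refine ⟨PresentedGroup.toGroup hg, PresentedGroup.toGroup.of hg, fun i => ?_⟩
  fin_cases i <;> exact PresentedGroup.toGroup.of hg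

theorem exists_orbifoldGroup_hom {H : Type*} [Group H] (u : Fin 3 → H)
    (hp : ∀ i, u i ^ a i = 1) (hm : u 0 * u 1 * u 2 = 1) :
    ∃ φ : OrbifoldGroup a →* H, ∀ i, φ (cone a i) = u i := by
  let g : OrbifoldGen → H := fun s => match s with
    | .x => u 0
    | .y => u 1
    | .z => u 2
  have hg : ∀ r ∈ orbifoldRels a, FreeGroup.lift g r = 1 := by
    intro r hr
    simp only [orbifoldRels, Set.mem_insert_iff, Set.mem_singleton_iff] at hr
    rcases hr with rfl | rfl | rfl | rfl <;> simp [g, hp, hm]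
  refine ⟨PresentedGroup.toGroup hg, fun i => ?_⟩
  fin_cases i <;> exact PresentedGroup.toGroup.of hg

theorem subgroup_eq_top_of_generators (K : Subgroup (SeifertGroup a b₀ b))
    (hf : fiber a b₀ b ∈ K) (hs : ∀ i, singular a b₀ b i ∈ K) : K = ⊤ := by
  rw [eq_top_iff, ← PresentedGroup.closure_range_of, Subgroup.closure_le]
  rintro _ ⟨s, rfl⟩
  cases s
  exacts [hs 0, hs 1, hs 2, hf]

theorem seifertGroup_hom_ext {H : Type*} [Group H] {φ ψ : SeifertGroup a b₀ b →* H}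
    (hf : φ (fiber a b₀ b) = ψ (fiber a b₀ b))
    (hs : ∀ i, φ (singular a b₀ b i) = ψ (singular a b₀ b i)) : φ = ψ := by
  have := subgroup_eq_top_of_generators (φ.eqLocus ψ) hf hs
  ext g
  exact (this ▸ Subgroup.mem_top _ : PresentedGroup.of g ∈ φ.eqLocus ψ)

theorem singular_two :
    singular a b₀ b 2 = (singular a b₀ b 0 * singular a b₀ b 1)⁻¹ * fiber a b₀ b ^ b₀ := by
  rw [← singular_prod]; group

theorem seifertGroup_hom_ext_of_pair {H : Type*} [Group H] {φ ψ : SeifertGroup a b₀ b →* H}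
    (hf : φ (fiber a b₀ b) = ψ (fiber a b₀ b))
    (h0 : φ (singular a b₀ b 0) = ψ (singular a b₀ b 0))
    (h1 : φ (singular a b₀ b 1) = ψ (singular a b₀ b 1)) : φ = ψ := by
  refine seifertGroup_hom_ext hf fun i => ?_
  fin_cases i
  · exact h0
  · exact h1
  · change φ (singular a b₀ b 2) = ψ (singular a b₀ b 2)
    rw [singular_two, map_mul, map_mul, map_inv, map_inv, map_mul, map_mul, map_zpow, map_zpow,
      hf, h0, h1]

theorem fiber_commute (g : SeifertGroup a b₀ b) : Commute (fiber a b₀ b) g := by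
  have := subgroup_eq_top_of_generators (Subgroup.centralizer {fiber a b₀ b})
    (Subgroup.mem_centralizer_singleton_iff.2 rfl)
    (fun i => Subgroup.mem_centralizer_singleton_iff.2 (fiber_commute_singular i).symm.eq)
  have h : g ∈ Subgroup.centralizer {fiber a b₀ b} := this ▸ Subgroup.mem_top g
  exact (Subgroup.mem_centralizer_singleton_iff.1 h).symm

theorem toOrbifold_fiber : toOrbifold a b₀ b (fiber a b₀ b) = 1 :=
  PresentedGroup.toGroup.of (toOrbifoldGen_rels a b₀ b)

theorem toOrbifold_singular (i : Fin 3) :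
    toOrbifold a b₀ b (singular a b₀ b i) = cone a i := by
  fin_cases i <;> exact PresentedGroup.toGroup.of (toOrbifoldGen_rels a b₀ b)

theorem toOrbifold_surjective : Function.Surjective (toOrbifold a b₀ b) := by
  rw [← MonoidHom.range_eq_top, eq_top_iff, ← PresentedGroup.closure_range_of,
    Subgroup.closure_le]
  rintro _ ⟨s, rfl⟩
  cases s
  exacts [⟨_, toOrbifold_singular 0⟩, ⟨_, toOrbifold_singular 1⟩, ⟨_, toOrbifold_singular 2⟩]

/-- The fiber generates a normal subgroup `N`, and the orbifold relations hold in the quotient by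
`N`. So the quotient map factors through `toOrbifold`, whose kernel therefore lies in `N`. -/
theorem mem_zpowers_fiber {g : SeifertGroup a b₀ b} (hg : toOrbifold a b₀ b g = 1) :
    ∃ n : ℤ, g = fiber a b₀ b ^ n := by
  let N := Subgroup.zpowers (fiber a b₀ b)
  have hN : N.Normal := ⟨fun n hn k => by
    obtain ⟨m, rfl⟩ := Subgroup.mem_zpowers_iff.1 hn
    rw [← ((fiber_commute k).zpow_left m).eq, mul_inv_cancel_right]
    exact hn⟩
  have hf : ∀ n : ℤ, QuotientGroup.mk' N (fiber a b₀ b ^ n) = 1 := fun n =>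
    (QuotientGroup.eq_one_iff _).2 (Subgroup.mem_zpowers_iff.2 ⟨n, rfl⟩)
  obtain ⟨φ, hφ⟩ := exists_orbifoldGroup_hom (a := a)
    (fun i => QuotientGroup.mk' N (singular a b₀ b i))
    (fun i => by rw [← map_pow, singular_pow, hf])
    (by rw [← map_mul, ← map_mul, singular_prod, hf])
  have : φ.comp (toOrbifold a b₀ b) = QuotientGroup.mk' N := by
    refine seifertGroup_hom_ext ?_ fun i => ?_
    · rw [MonoidHom.comp_apply, toOrbifold_fiber, map_one]
      simpa using (hf 1).symm
    · rw [MonoidHom.comp_apply, toOrbifold_singular, hφ]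
  have h1 := DFunLike.congr_fun this g
  rw [MonoidHom.comp_apply, hg, map_one] at h1
  obtain ⟨n, hn⟩ := Subgroup.mem_zpowers_iff.1 ((QuotientGroup.eq_one_iff g).1 h1.symm)
  exact ⟨n, hn.symm⟩

/-- The condition that the Seifert fibered space is an integral homology sphere, with denominators
cleared. -/
theorem homology_sphere_int (ha : ∀ i, 0 < a i)
    (hb : (∏ i, (a i : ℚ)) * ((b₀ : ℚ) + ∑ i, (b i : ℚ) / (a i : ℚ)) = 1) :
    (a 0 : ℤ) * a 1 * a 2 * b₀ + b 0 * (a 1 * a 2) + b 1 * (a 0 * a 2) + b 2 * (a 0 * a 1)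
      = 1 := by
  have h : ∀ i, (a i : ℚ) ≠ 0 := fun i => by exact_mod_cast (ha i).ne'
  have h0 := h 0
  have h1 := h 1
  have h2 := h 2
  rw [Fin.prod_univ_three, Fin.sum_univ_three] at hb
  field_simp at hb
  have : (a 0 : ℚ) * a 1 * a 2 * b₀ + b 0 * (a 1 * a 2) + b 1 * (a 0 * a 2) + b 2 * (a 0 * a 1)
      = 1 := by linarith
  exact_mod_cast this

/-- In a commutative group the relations form a square integral linear system whose determinant is,
up to sign, the left side of `hb`. Being unimodular, it has only the zero solution; the coefficients
below are cofactors. -/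
theorem seifertGroup_hom_comm_eq_one {A : Type*} [CommGroup A]
    (hb : (a 0 : ℤ) * a 1 * a 2 * b₀ + b 0 * (a 1 * a 2) + b 1 * (a 0 * a 2) + b 2 * (a 0 * a 1)
      = 1) (φ : SeifertGroup a b₀ b →* A) : φ = 1 := by
  set T : Additive A := Additive.ofMul (φ (fiber a b₀ b)) with hT
  set U : Fin 3 → Additive A := fun i => Additive.ofMul (φ (singular a b₀ b i)) with hU
  have hp : ∀ i, (a i : ℤ) • U i = -b i • T := fun i => by
    rw [natCast_zsmul]
    change Additive.ofMul (φ (singular a b₀ b i) ^ a i) = Additive.ofMul (φ (fiber a b₀ b) ^ (-b i))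
    rw [← map_pow, singular_pow, map_zpow]
  have hm : U 0 + U 1 + U 2 = b₀ • T := by
    change Additive.ofMul (φ (singular a b₀ b 0) * φ (singular a b₀ b 1) * φ (singular a b₀ b 2)) =
      Additive.ofMul (φ (fiber a b₀ b) ^ b₀)
    rw [← map_mul, ← map_mul, singular_prod, map_zpow]
  have p0 := hp 0
  have p1 := hp 1
  have p2 := hp 2
  have hT0 : T = 0 := by
    have h1 : T = (1 : ℤ) • T := (one_zsmul T).symm
    rw [h1, ← hb]
    linear_combination (norm := module) (-(a 0 * a 1 * a 2 : ℤ)) • hm + ((a 1 * a 2 : ℤ)) • p0 +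
      ((a 0 * a 2 : ℤ)) • p1 + ((a 0 * a 1 : ℤ)) • p2
  rw [hT0] at hm p0 p1 p2
  have e0 : U 0 = 0 := by
    have h1 : U 0 = (1 : ℤ) • U 0 := (one_zsmul _).symm
    rw [h1, ← hb]
    linear_combination (norm := module) ((a 1 * a 2 * b₀ + b 1 * a 2 + b 2 * a 1 : ℤ)) • p0 +
      (b 0 * a 1 * a 2 : ℤ) • hm - (b 0 * a 2 : ℤ) • p1 - (b 0 * a 1 : ℤ) • p2
  have e1 : U 1 = 0 := by
    have h1 : U 1 = (1 : ℤ) • U 1 := (one_zsmul _).symm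
    rw [h1, ← hb]
    linear_combination (norm := module) ((a 0 * a 2 * b₀ + b 0 * a 2 + b 2 * a 0 : ℤ)) • p1 +
      (b 1 * a 0 * a 2 : ℤ) • hm - (b 1 * a 2 : ℤ) • p0 - (b 1 * a 0 : ℤ) • p2
  have e2 : U 2 = 0 := by
    have h1 : U 2 = (1 : ℤ) • U 2 := (one_zsmul _).symm
    rw [h1, ← hb]
    linear_combination (norm := module) ((a 0 * a 1 * b₀ + b 0 * a 1 + b 1 * a 0 : ℤ)) • p2 +
      (b 2 * a 0 * a 1 : ℤ) • hm - (b 2 * a 1 : ℤ) • p0 - (b 2 * a 0 : ℤ) • p1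
  refine seifertGroup_hom_ext hT0 fun i => ?_
  fin_cases i
  exacts [e0, e1, e2]

theorem commutator_seifertGroup
    (hb : (a 0 : ℤ) * a 1 * a 2 * b₀ + b 0 * (a 1 * a 2) + b 1 * (a 0 * a 2) + b 2 * (a 0 * a 1)
      = 1) : commutator (SeifertGroup a b₀ b) = ⊤ := by
  rw [← Abelianization.ker_of, seifertGroup_hom_comm_eq_one hb Abelianization.of,
    MonoidHom.ker_one]

/-- Two homomorphisms from a perfect Seifert group which agree on generators up to central
elements are equal. -/
theorem seifertGroup_hom_eq_of_center {H : Type*} [Group H]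
    (hb : (a 0 : ℤ) * a 1 * a 2 * b₀ + b 0 * (a 1 * a 2) + b 1 * (a 0 * a 2) + b 2 * (a 0 * a 1)
      = 1) (φ ψ : SeifertGroup a b₀ b →* H)
    (hf : φ (fiber a b₀ b) * (ψ (fiber a b₀ b))⁻¹ ∈ Subgroup.center H)
    (h0 : φ (singular a b₀ b 0) * (ψ (singular a b₀ b 0))⁻¹ ∈ Subgroup.center H)
    (h1 : φ (singular a b₀ b 1) * (ψ (singular a b₀ b 1))⁻¹ ∈ Subgroup.center H) :
    φ = ψ := by
  let π := QuotientGroup.mk' (Subgroup.center H)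
  have key : ∀ g, φ g * (ψ g)⁻¹ ∈ Subgroup.center H ↔ π (φ g) = π (ψ g) := fun g => by
    rw [← mul_inv_eq_one, ← map_inv π, ← map_mul π]
    exact (QuotientGroup.eq_one_iff _).symm
  have hπ : π.comp φ = π.comp ψ :=
    seifertGroup_hom_ext_of_pair ((key _).1 hf) ((key _).1 h0) ((key _).1 h1)
  have hz : ∀ g, φ g * (ψ g)⁻¹ ∈ Subgroup.center H := fun g =>
    (key g).2 (DFunLike.congr_fun hπ g)
  let _ : CommGroup (Subgroup.center H) :=
    { (inferInstance : Group (Subgroup.center H)) with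
      mul_comm := fun x y => Subtype.ext (Subgroup.mem_center_iff.1 y.2 x) }
  -- The quotient of two homomorphisms that agree modulo the center is itself a homomorphism, with
  -- commutative target, and so it is trivial.
  let χ : SeifertGroup a b₀ b →* Subgroup.center H :=
    { toFun := fun g => ⟨φ g * (ψ g)⁻¹, hz g⟩
      map_one' := by ext; simp
      map_mul' := fun g k => by
        ext
        have := Subgroup.mem_center_iff.1 (hz k) (ψ g)⁻¹
        simp only [map_mul, mul_inv_rev, Subgroup.coe_mul]
        rw [mul_assoc (φ g), mul_assoc (φ g), this]
        group }
  ext s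
  have h1 := DFunLike.congr_fun (seifertGroup_hom_comm_eq_one (A := Subgroup.center H) hb χ)
    (PresentedGroup.of s)
  exact mul_inv_eq_one.1 (congrArg Subtype.val h1)

end SeifertGroup

/-! ### Matrices in `SL(2)` -/

theorem mem_center_sl2 {K : Type*} [Field K] (A : Matrix.SpecialLinearGroup (Fin 2) K) :
    A ∈ Subgroup.center (Matrix.SpecialLinearGroup (Fin 2) K) ↔ A = 1 ∨ A = -1 := by
  rw [Matrix.SpecialLinearGroup.mem_center_iff]
  constructor
  · rintro ⟨r, hr, h⟩
    rw [Fintype.card_fin, sq_eq_one_iff] at hr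
    rcases hr with rfl | rfl
    · left; ext i j; rw [← h]; simp
    · right; ext i j; rw [← h]; simp [Matrix.one_apply, Matrix.diagonal_apply]
      split_ifs <;> simp
  · rintro (rfl | rfl)
    · exact ⟨1, by simp, by simp⟩
    · refine ⟨-1, by simp, ?_⟩
      rw [map_neg, map_one]; simp

theorem sl2_det {K : Type*} [CommRing K] (A : Matrix.SpecialLinearGroup (Fin 2) K) :
    A.1 0 0 * A.1 1 1 - A.1 0 1 * A.1 1 0 = 1 := by
  rw [← Matrix.det_fin_two]; exact A.2

/-- A matrix in `SL(2)` of finite order with a double eigenvalue is scalar. -/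
theorem eq_scalar_of_pow_eq_one {K : Type*} [Field K] [CharZero K]
    (A : Matrix.SpecialLinearGroup (Fin 2) K) {n : ℕ} (hn : 0 < n) (hA : A ^ n = 1) {ε : K}
    (hε : ε ^ 2 = 1) (ht : A.1.trace = 2 * ε) : A.1 = ε • (1 : Matrix (Fin 2) (Fin 2) K) := by
  set N : Matrix (Fin 2) (Fin 2) K := A.1 - ε • (1 : Matrix (Fin 2) (Fin 2) K) with hN
  have hd := sl2_det A
  rw [Matrix.trace_fin_two] at ht
  -- Cayley–Hamilton with double eigenvalue `ε`. Hence `A ^ n = ε ^ n + n ε ^ (n-1) N`, and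
  -- characteristic zero forces `N = 0`.
  have hNN : N * N = 0 := by
    ext i j
    fin_cases i <;> fin_cases j <;>
      simp [hN, Matrix.mul_apply, Fin.sum_univ_two] <;>
      first
      | linear_combination A.1 0 0 * ht - hd + hε
      | linear_combination A.1 1 1 * ht - hd + hε
      | linear_combination A.1 0 1 * ht
      | linear_combination A.1 1 0 * ht
  have hA' : A.1 = ε • (1 : Matrix (Fin 2) (Fin 2) K) + N := by rw [hN]; abel
  have hpow : ∀ m : ℕ, A.1 ^ (m + 1) =
      ε ^ (m + 1) • (1 : Matrix (Fin 2) (Fin 2) K) + ((m + 1 : ℕ) * ε ^ m) • N := by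
    intro m
    induction m with
    | zero => simpa using hA'
    | succ m ih =>
      rw [pow_succ, ih, hA', add_mul, mul_add, mul_add]
      simp only [smul_mul_assoc, mul_smul_comm, one_mul, mul_one, hNN, smul_zero, add_zero,
        smul_smul]
      push_cast
      module
  obtain ⟨m, rfl⟩ := Nat.exists_eq_succ_of_ne_zero hn.ne'
  have h1 : A.1 ^ (m + 1) = 1 := by
    have := congrArg Subtype.val hA
    simpa using this
  rw [hpow m] at h1
  have hNt : N.trace = 0 := by
    simp [hN, Matrix.trace_fin_two]
    linear_combination ht
  -- `N` has trace zero, so the trace isolates the scalar part.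
  have hεn : ε ^ (m + 1) = 1 := by
    have := congrArg Matrix.trace h1
    rw [Matrix.trace_add, Matrix.trace_smul, Matrix.trace_smul, hNt] at this
    simpa using this
  have hε0 : ε ≠ 0 := by rintro rfl; simp at hε
  rw [hεn, one_smul, add_eq_left, smul_eq_zero] at h1
  have : N = 0 := h1.resolve_left
    (mul_ne_zero (Nat.cast_ne_zero.2 (Nat.succ_ne_zero m)) (pow_ne_zero _ hε0))
  rw [hA', this, add_zero]

theorem exists_eigenvector (A : Matrix (Fin 2) (Fin 2) ℂ) :
    ∃ (l : ℂ) (v : Fin 2 → ℂ), v ≠ 0 ∧ A.mulVec v = l • v := by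
  obtain ⟨l, hl⟩ := Module.End.exists_eigenvalue (Matrix.toLin' A)
  obtain ⟨v, hv⟩ := hl.exists_hasEigenvector
  exact ⟨l, v, hv.2, by simpa using hv.apply_eq_smul⟩

/-- The characteristic equation, in the form that exhibits `A.1.trace - l` as the inverse, and hence
the other eigenvalue. -/
theorem eigenvalue_eq {K : Type*} [Field K] (A : Matrix.SpecialLinearGroup (Fin 2) K) {l : K}
    {v : Fin 2 → K} (hv : v ≠ 0) (h : A.1.mulVec v = l • v) : l * (A.1.trace - l) = 1 := by
  have hd := sl2_det A
  have h0 := congrFun h 0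
  have h1 := congrFun h 1
  simp [Matrix.mulVec, dotProduct, Fin.sum_univ_two] at h0 h1
  rw [Matrix.trace_fin_two]
  by_cases hv0 : v 0 = 0
  · have hv1 : v 1 ≠ 0 := fun h1 => hv (by ext i; fin_cases i <;> assumption)
    apply mul_right_cancel₀ hv1
    linear_combination A.1 1 0 * h0 - (A.1 0 0 - l) * h1 + v 1 * hd
  · apply mul_right_cancel₀ hv0
    linear_combination A.1 0 1 * h1 - (A.1 1 1 - l) * h0 + v 0 * hd

theorem pow_mulVec_eigenvector {K : Type*} [Field K] (A : Matrix (Fin 2) (Fin 2) K) {l : K}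
    {v : Fin 2 → K} (h : A.mulVec v = l • v) (n : ℕ) : (A ^ n).mulVec v = l ^ n • v := by
  induction n with
  | zero => simp
  | succ n ih => rw [pow_succ', ← Matrix.mulVec_mulVec, ih, Matrix.mulVec_smul, h, smul_smul,
      pow_succ]

/-- The trace of an element of finite order of `SL(2; ℂ)`. -/
theorem exists_trace_of_pow_eq_one (A : SL2C) {n : ℕ} (hA : A ^ n = 1) :
    ∃ l : ℂ, l ^ n = 1 ∧ l * (A.1.trace - l) = 1 := by
  obtain ⟨l, v, hv, h⟩ := exists_eigenvector A.1
  refine ⟨l, ?_, eigenvalue_eq A hv h⟩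
  have h1 := pow_mulVec_eigenvector A.1 h n
  have h2 : A.1 ^ n = 1 := by simpa using congrArg Subtype.val hA
  rw [h2, Matrix.one_mulVec] at h1
  have h3 : (l ^ n - 1) • v = 0 := by rw [sub_smul, ← h1, one_smul, sub_self]
  exact sub_eq_zero.1 ((smul_eq_zero.1 h3).resolve_right hv)

/-- An elliptic element of `SL(2; ℝ)` is conjugate to a rotation. -/
theorem exists_conj_rotation (A : SL2R) {θ : ℝ} (ht : A.1.trace = 2 * Real.cos θ)
    (hs : 0 < Real.sin θ * A.1 1 0) :
    ∃ P : SL2R, A = P * rotation (θ / Real.pi) * P⁻¹ := by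
  have hs0 : Real.sin θ ≠ 0 := by rintro h; simp [h] at hs
  have hr0 : A.1 1 0 ≠ 0 := by rintro h; simp [h] at hs
  have hq : 0 < Real.sin θ / A.1 1 0 := by
    rw [div_eq_mul_inv, ← mul_pos_iff_of_pos_right (sq_pos_of_ne_zero hr0)]
    field_simp
    exact hs
  set k := √(Real.sin θ / A.1 1 0) with hk
  have hkk : k * k = Real.sin θ / A.1 1 0 := Real.mul_self_sqrt hq.le
  have hd := sl2_det A
  rw [Matrix.trace_fin_two] at ht
  have hcs := Real.sin_sq_add_cos_sq θ
  have hπ : Real.pi * (θ / Real.pi) = θ := by field_simp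
  -- The columns are `k e₀` and `k (A e₀ - cos θ e₀) / sin θ`, a basis in which `A` is the rotation
  -- by `θ`. The determinant is `k² A₁₀ / sin θ`; the sign hypothesis `hs` is what allows it to be
  -- `1` for a real `k`.
  let P : SL2R := ⟨!![k, k * (A.1 0 0 - Real.cos θ) / Real.sin θ; 0, k * A.1 1 0 / Real.sin θ], by
    rw [Matrix.det_fin_two_of, mul_zero, sub_zero, ← mul_div_assoc, ← mul_assoc, hkk]
    field_simp⟩
  refine ⟨P, eq_mul_inv_of_mul_eq ?_⟩
  refine Subtype.ext ?_
  rw [Matrix.SpecialLinearGroup.coe_mul, Matrix.SpecialLinearGroup.coe_mul]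
  ext i j
  fin_cases i <;> fin_cases j <;>
    simp [P, rotation, Matrix.mul_apply, Fin.sum_univ_two, hπ]
  · field_simp; ring
  · field_simp
    linear_combination k * (A.1 0 0 * ht - hd + hcs)
  · field_simp
  · field_simp
    linear_combination k * ht

/-! ### The universal cover of `PSL(2; ℝ)` -/

theorem circleVec_sq (t : ℝ) : circleVec t 0 ^ 2 + circleVec t 1 ^ 2 = 1 := by
  simp [circleVec]

theorem exists_int_of_circleVec_eq {s t c : ℝ} (hc : 0 < c)
    (h : circleVec t = c • circleVec s) : ∃ n : ℤ, s = t + 2 * n := by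
  have h0 := congrFun h 0
  have h1 := congrFun h 1
  simp only [Pi.smul_apply, smul_eq_mul] at h0 h1
  have ht := circleVec_sq t
  rw [h0, h1] at ht
  have hc1 : c = 1 := by
    have : c ^ 2 = 1 := by linear_combination ht - c ^ 2 * circleVec_sq s
    nlinarith
  rw [hc1, one_mul] at h0 h1
  simp only [circleVec, Matrix.cons_val_zero, Matrix.cons_val_one] at h0 h1
  have he : Complex.exp ((Real.pi * s : ℝ) * Complex.I) =
      Complex.exp ((Real.pi * t : ℝ) * Complex.I) := by
    rw [Complex.exp_mul_I, Complex.exp_mul_I, ← Complex.ofReal_cos, ← Complex.ofReal_sin,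
      ← Complex.ofReal_cos, ← Complex.ofReal_sin, h0, h1]
  obtain ⟨n, hn⟩ := Complex.exp_eq_exp_iff_exists_int.1 he
  refine ⟨n, ?_⟩
  have h2 : ((Real.pi * s : ℝ) : ℂ) = ((Real.pi * t + n * (2 * Real.pi) : ℝ) : ℂ) := by
    apply mul_right_cancel₀ Complex.I_ne_zero
    rw [hn]; push_cast; ring
  have h3 := Complex.ofReal_injective h2
  apply mul_left_cancel₀ Real.pi_ne_zero
  rw [h3]; ring

theorem IsLift.exists_eq_add {φ : ℝ ≃ₜ ℝ} (h : IsLift 1 φ) : ∃ n : ℤ, ∀ t, φ t = t + 2 * n := by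
  have hp : ∀ t, ∃ n : ℤ, φ t = t + 2 * n := fun t => by
    obtain ⟨c, hc, e⟩ := h t
    rw [Matrix.SpecialLinearGroup.coe_one, Matrix.one_mulVec] at e
    exact exists_int_of_circleVec_eq hc e
  have hcont : Continuous fun t => (φ t - t) / 2 := by fun_prop
  have hT : IsDiscrete (Set.range ((↑) : ℤ → ℝ)) :=
    Int.isClosedEmbedding_coe_real.isEmbedding.isDiscrete_range
  -- The integer depends continuously on `t`, so it is constant.
  obtain ⟨_, ⟨n, rfl⟩, hn⟩ := isPreconnected_univ.eqOn_const_of_mapsTo hT hcont.continuousOn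
    (fun t _ => by
      obtain ⟨n, hn⟩ := hp t
      exact ⟨n, by rw [hn]; ring⟩) ⟨0, 0, by simp⟩
  refine ⟨n, fun t => ?_⟩
  have := hn (Set.mem_univ t)
  simp only [Function.const_apply] at this
  linarith

/-! ### Translations and the kernels of the projections to `SL(2; ℝ)` and `PSL(2; ℝ)`. -/

@[simp] theorem sh_apply (r t : ℝ) : (sh r : ℝ ≃ₜ ℝ) t = t + r := rfl

theorem univPSL_ext {φ ψ : UnivPSL} (h : ∀ t, (φ : ℝ ≃ₜ ℝ) t = (ψ : ℝ ≃ₜ ℝ) t) : φ = ψ :=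
  Subtype.ext (Homeomorph.ext h)

theorem univPSL_mul_apply (φ ψ : UnivPSL) (t : ℝ) :
    ((φ * ψ : UnivPSL) : ℝ ≃ₜ ℝ) t = (φ : ℝ ≃ₜ ℝ) ((ψ : ℝ ≃ₜ ℝ) t) := rfl

theorem sh_add (r s : ℝ) : sh (r + s) = sh r * sh s :=
  univPSL_ext fun t => by rw [univPSL_mul_apply]; simp; ring

@[simp] theorem sh_zero : sh 0 = 1 := univPSL_ext fun t => by simp

/-- Translations as a homomorphism from the additive group of the reals. -/
noncomputable def shHom : Multiplicative ℝ →* UnivPSL where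
  toFun r := sh r.toAdd
  map_one' := sh_zero
  map_mul' _ _ := sh_add _ _

theorem sh_neg (r : ℝ) : sh (-r) = (sh r)⁻¹ := map_inv shHom (Multiplicative.ofAdd r)

theorem sh_pow (r : ℝ) (n : ℕ) : sh r ^ n = sh (n * r) := by
  rw [← nsmul_eq_mul]
  exact (map_pow shHom (Multiplicative.ofAdd r) n).symm

theorem sh_zpow (r : ℝ) (n : ℤ) : sh r ^ n = sh (n * r) := by
  rw [← zsmul_eq_mul]
  exact (map_zpow shHom (Multiplicative.ofAdd r) n).symm

theorem sh_injective : Function.Injective sh := fun _ _ h => by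
  have := congrArg (fun φ : UnivPSL => (φ : ℝ ≃ₜ ℝ) 0) h
  simpa using this

theorem toSL_eq_of_isLift {φ : UnivPSL} {A : SL2R} (h : IsLift A φ) : UnivPSL.toSL φ = A :=
  (UnivPSL.isLift_toSL φ).unique h

theorem toSL_sh (r : ℝ) : UnivPSL.toSL (sh r) = rotation r := toSL_eq_of_isLift (isLift_rotation r)

theorem exists_sh_of_toSL_eq_one {φ : UnivPSL} (h : UnivPSL.toSL φ = 1) :
    ∃ n : ℤ, φ = sh (2 * n) := by
  obtain ⟨n, hn⟩ := (h ▸ UnivPSL.isLift_toSL φ : IsLift 1 φ).exists_eq_add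
  exact ⟨n, univPSL_ext hn⟩

theorem rotation_one : rotation 1 = -1 := by
  ext i j; fin_cases i <;> fin_cases j <;> simp [rotation]

theorem rotation_int (n : ℤ) : rotation n = (-1) ^ n := by
  rw [← rotation_one, ← toSL_sh, ← toSL_sh, ← map_zpow, sh_zpow, mul_one]

theorem exists_sh_of_toPSL_eq_one {φ : UnivPSL} (h : UnivPSL.toPSL φ = 1) :
    ∃ n : ℤ, φ = sh n := by
  have hc : UnivPSL.toSL φ ∈ Subgroup.center SL2R := (QuotientGroup.eq_one_iff _).1 h
  rcases (mem_center_sl2 _).1 hc with h1 | h1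
  · obtain ⟨n, hn⟩ := exists_sh_of_toSL_eq_one h1
    exact ⟨2 * n, by rw [hn]; push_cast; rfl⟩
  -- Since `sh 1` lies over `-1`, multiplying by it reduces to the kernel of `toSL`.
  · have : UnivPSL.toSL (φ * sh 1) = 1 := by
      rw [map_mul, h1, toSL_sh, rotation_one]; simp
    obtain ⟨n, hn⟩ := exists_sh_of_toSL_eq_one this
    refine ⟨2 * n - 1, ?_⟩
    rw [eq_mul_inv_of_mul_eq hn, ← sh_neg, ← sh_add]
    push_cast; rfl

theorem toPSL_sh_int (n : ℤ) : UnivPSL.toPSL (sh n) = 1 := by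
  refine (QuotientGroup.eq_one_iff _).2 ?_
  change UnivPSL.toSL (sh n) ∈ _
  rw [toSL_sh, rotation_int]
  exact zpow_mem ((mem_center_sl2 _).2 (Or.inr rfl)) n

/-! #### Lifting matrices -/

/-- The complex number `(A v) / v`, for `v` the unit vector `(cos πt, sin πt)`. -/
noncomputable def turning (A : SL2R) (t : ℝ) : ℂ :=
  ⟨A.1.mulVec (circleVec t) 0 * circleVec t 0 + A.1.mulVec (circleVec t) 1 * circleVec t 1,
    A.1.mulVec (circleVec t) 1 * circleVec t 0 - A.1.mulVec (circleVec t) 0 * circleVec t 1⟩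

/-- If `(A v) / v` were real and nonpositive, `v` would be an eigenvector with eigenvalue `l < 0`,
and the trace `l + l⁻¹` would be at most `-2`. Off the slit the argument is continuous, so it can be
used to lift `A`. -/
theorem turning_mem_slitPlane {A : SL2R} (hA : -2 < A.1.trace) (t : ℝ) :
    turning A t ∈ Complex.slitPlane := by
  rw [Complex.mem_slitPlane_iff]
  by_contra! hcon
  obtain ⟨h1, h2⟩ := hcon
  have hsq := circleVec_sq t
  set l := (turning A t).re with hl
  simp only [turning] at h2 hl
  have hv : circleVec t ≠ 0 := fun h => by simp [h] at hsq
  have he := eigenvalue_eq A (l := l) hv (by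
    ext i
    fin_cases i
    · simp only [Fin.zero_eta, Pi.smul_apply, smul_eq_mul, hl]
      linear_combination (-(A.1.mulVec (circleVec t) 0)) * hsq - circleVec t 1 * h2
    · simp only [Fin.mk_one, Pi.smul_apply, smul_eq_mul, hl]
      linear_combination (-(A.1.mulVec (circleVec t) 1)) * hsq + circleVec t 0 * h2)
  have : l < 0 := lt_of_le_of_ne h1 (by rintro h; simp [h] at he)
  nlinarith [sq_nonneg (l + 1)]

/-- The lift to `ℝ` of the action of a matrix without negative eigenvalues which fixes the lifts of
its eigenlines. -/
noncomputable def turn (A : SL2R) (t : ℝ) : ℝ := t + (turning A t).arg / Real.pi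

theorem circleVec_add_one (t : ℝ) : circleVec (t + 1) = -circleVec t := by
  ext i; fin_cases i <;> simp [circleVec, mul_add, Real.cos_add, Real.sin_add]

theorem turn_add_one (A : SL2R) (t : ℝ) : turn A (t + 1) = turn A t + 1 := by
  have : turning A (t + 1) = turning A t := by
    simp only [turning, circleVec_add_one, Matrix.mulVec_neg, Pi.neg_apply]
    congr 1 <;> ring
  rw [turn, turn, this]; ring

theorem continuous_turning (A : SL2R) : Continuous (turning A) := by
  have h0 : Continuous fun t => circleVec t 0 := by simp only [circleVec]; simp; fun_prop
  have h1 : Continuous fun t => circleVec t 1 := by simp only [circleVec]; simp; fun_prop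
  have : turning A = fun t => Complex.equivRealProdCLM.symm
      ((turning A t).re, (turning A t).im) := by
    funext t; apply Complex.ext <;> simp
  rw [this]
  refine Complex.equivRealProdCLM.symm.continuous.comp ?_
  simp only [turning, Matrix.mulVec, dotProduct, Fin.sum_univ_two]
  fun_prop

theorem continuous_turn {A : SL2R} (hA : -2 < A.1.trace) : Continuous (turn A) := by
  have : Continuous fun t => (turning A t).arg := by
    rw [continuous_iff_continuousAt]
    exact fun t => ContinuousAt.comp (Complex.continuousAt_arg (turning_mem_slitPlane hA t))
      (continuous_turning A).continuousAt
  unfold turn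
  fun_prop

theorem abs_turn_sub_lt {A : SL2R} (hA : -2 < A.1.trace) (t : ℝ) : |turn A t - t| < 1 := by
  have h1 : |(turning A t).arg| < Real.pi :=
    abs_lt.2 ⟨Complex.neg_pi_lt_arg _, lt_of_le_of_ne (Complex.arg_le_pi _)
      (Complex.mem_slitPlane_iff_arg.1 (turning_mem_slitPlane hA t)).1⟩
  rw [turn, add_sub_cancel_left, abs_div, abs_of_pos Real.pi_pos, div_lt_one Real.pi_pos]
  exact h1

theorem mulVec_circleVec_turn {A : SL2R} (hA : -2 < A.1.trace) (t : ℝ) :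
    ∃ c : ℝ, 0 < c ∧ A.1.mulVec (circleVec t) = c • circleVec (turn A t) := by
  have hz := turning_mem_slitPlane hA t
  have hsq := circleVec_sq t
  refine ⟨‖turning A t‖, norm_pos_iff.2 (Complex.slitPlane_ne_zero hz), ?_⟩
  have hre := Complex.norm_mul_cos_arg (turning A t)
  have him := Complex.norm_mul_sin_arg (turning A t)
  have hπ : Real.pi * turn A t = Real.pi * t + (turning A t).arg := by
    unfold turn; field_simp [Real.pi_ne_zero]
  have c0 : circleVec (turn A t) 0 = circleVec t 0 * Real.cos (turning A t).arg -
      circleVec t 1 * Real.sin (turning A t).arg := by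
    simp [circleVec, hπ, Real.cos_add]
  have c1 : circleVec (turn A t) 1 = circleVec t 1 * Real.cos (turning A t).arg +
      circleVec t 0 * Real.sin (turning A t).arg := by
    simp [circleVec, hπ, Real.sin_add]
  simp only [turning] at hre him
  ext i
  fin_cases i
  · simp only [Fin.zero_eta, Pi.smul_apply, smul_eq_mul, c0, turning]
    linear_combination (-(A.1.mulVec (circleVec t) 0)) * hsq - circleVec t 0 * hre
      + circleVec t 1 * him
  · simp only [Fin.mk_one, Pi.smul_apply, smul_eq_mul, c1, turning]
    linear_combination (-(A.1.mulVec (circleVec t) 1)) * hsq - circleVec t 1 * hre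
      - circleVec t 0 * him

/-- The composite lifts the identity on rays, so it moves `t` by an even integer; each factor moves
points by less than `1`, so this integer is `0`. -/
theorem turn_turn_inv {A B : SL2R} (hA : -2 < A.1.trace) (hB : -2 < B.1.trace) (hAB : A * B = 1)
    (t : ℝ) : turn A (turn B t) = t := by
  obtain ⟨c, hc, e⟩ := mulVec_circleVec_turn hB t
  obtain ⟨d, hd, e'⟩ := mulVec_circleVec_turn hA (turn B t)
  have h := congrArg (A.1.mulVec) e
  rw [Matrix.mulVec_mulVec, ← Matrix.SpecialLinearGroup.coe_mul, hAB, Matrix.mulVec_smul, e',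
    smul_smul, Matrix.SpecialLinearGroup.coe_one, Matrix.one_mulVec] at h
  obtain ⟨n, hn⟩ := exists_int_of_circleVec_eq (mul_pos hc hd) h
  have h1 := abs_lt.1 (abs_turn_sub_lt hB t)
  have h2 := abs_lt.1 (abs_turn_sub_lt hA (turn B t))
  have n1 : (-1 : ℝ) < n := by linarith
  have n2 : (n : ℝ) < 1 := by linarith
  have : n = 0 := by
    have : -1 < n := by exact_mod_cast n1
    have : n < 1 := by exact_mod_cast n2
    omega
  rw [hn, this]; simp

theorem trace_inv (A : SL2R) : (A⁻¹).1.trace = A.1.trace := by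
  rw [Matrix.SpecialLinearGroup.coe_inv, Matrix.adjugate_fin_two, Matrix.trace_fin_two,
    Matrix.trace_fin_two]
  simp [add_comm]

/-- Every matrix in `SL(2; ℝ)` lifts to the universal cover, and `sh 1` is central. -/
theorem exists_toSL_eq (A : SL2R) :
    ∃ φ : UnivPSL, UnivPSL.toSL φ = A ∧ ∀ t, (φ : ℝ ≃ₜ ℝ) (t + 1) = (φ : ℝ ≃ₜ ℝ) t + 1 := by
  have main : ∀ B : SL2R, -2 < B.1.trace → ∃ φ : UnivPSL, UnivPSL.toSL φ = B ∧
      ∀ t, (φ : ℝ ≃ₜ ℝ) (t + 1) = (φ : ℝ ≃ₜ ℝ) t + 1 := by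
    intro B hB
    have hB' : -2 < (B⁻¹).1.trace := by rwa [trace_inv]
    let φ : ℝ ≃ₜ ℝ :=
      { toFun := turn B
        invFun := turn B⁻¹
        left_inv := turn_turn_inv hB' hB (inv_mul_cancel B)
        right_inv := turn_turn_inv hB hB' (mul_inv_cancel B)
        continuous_toFun := continuous_turn hB
        continuous_invFun := continuous_turn hB' }
    have hφ : IsLift B φ := mulVec_circleVec_turn hB
    exact ⟨⟨φ, B, hφ⟩, toSL_eq_of_isLift hφ, turn_add_one B⟩
  by_cases hA : -2 < A.1.trace
  · exact main A hA
  -- When the trace is at most `-2`, `-A` has a lift of the first kind, and `sh 1` lifts `-1`.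
  · obtain ⟨φ, h1, h2⟩ := main (-A) (by
      rw [Matrix.SpecialLinearGroup.coe_neg, Matrix.trace_neg]; linarith)
    refine ⟨φ * sh 1, ?_, fun t => ?_⟩
    · rw [map_mul, h1, toSL_sh, rotation_one]; simp
    · simp only [univPSL_mul_apply, sh_apply, h2]

/-! ### Centrality of integral translations and monotonicity. -/

theorem univPSL_add_one (φ : UnivPSL) (t : ℝ) : (φ : ℝ ≃ₜ ℝ) (t + 1) = (φ : ℝ ≃ₜ ℝ) t + 1 := by
  obtain ⟨ψ, h1, h2⟩ := exists_toSL_eq (UnivPSL.toSL φ)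
  obtain ⟨n, hn⟩ := exists_sh_of_toSL_eq_one (φ := φ * ψ⁻¹) (by rw [map_mul, map_inv, h1]; simp)
  have h3 : φ = sh (2 * n) * ψ := by rw [← hn]; group
  rw [h3]
  simp only [univPSL_mul_apply, sh_apply, h2]; ring

theorem sh_int_commute (n : ℤ) (φ : UnivPSL) : Commute (sh n) φ := by
  have h : Commute (sh 1) φ := univPSL_ext fun t => by
    simp only [univPSL_mul_apply, sh_apply, univPSL_add_one]
  have := h.zpow_left n
  rwa [sh_zpow, mul_one] at this

theorem univPSL_strictMono (φ : UnivPSL) : StrictMono (φ : ℝ ≃ₜ ℝ) := by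
  rcases (φ : ℝ ≃ₜ ℝ).continuous.strictMono_of_inj (φ : ℝ ≃ₜ ℝ).injective with h | h
  · exact h
  · have := h (lt_add_one (0 : ℝ))
    rw [univPSL_add_one] at this
    linarith

/-- A lift of a conjugate of a rotation is conjugate to a translation. -/
theorem exists_conj_sh {φ : UnivPSL} {Q : SL2R} {r : ℝ}
    (h : UnivPSL.toSL φ = Q * rotation r * Q⁻¹) :
    ∃ (P : UnivPSL) (n : ℤ), φ = P * sh (r + 2 * n) * P⁻¹ := by
  obtain ⟨P, rfl, -⟩ := exists_toSL_eq Q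
  obtain ⟨n, hn⟩ := exists_sh_of_toSL_eq_one (φ := (sh r)⁻¹ * (P⁻¹ * φ * P)) (by
    simp only [map_mul, map_inv, h, toSL_sh]; group)
  refine ⟨P, n, ?_⟩
  rw [sh_add, ← hn]; group

/-! ### Elements of finite order and their lifts. -/

theorem map_ofReal_trace (A : SL2R) :
    (Matrix.SpecialLinearGroup.map (algebraMap ℝ ℂ) A).1.trace = (A.1.trace : ℂ) := by
  simp [Matrix.trace_fin_two]

/-- A matrix of finite order in `SL(2; ℝ)` is conjugate to a rotation. -/
theorem exists_conj_rotation_of_pow_eq_one {A : SL2R} {n : ℕ} (hn : 0 < n) (hA : A ^ n = 1) :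
    ∃ (Q : SL2R) (r : ℝ), A = Q * rotation r * Q⁻¹ := by
  obtain ⟨l, hl, hl'⟩ := exists_trace_of_pow_eq_one
    (Matrix.SpecialLinearGroup.map (algebraMap ℝ ℂ) A) (n := n) (by rw [← map_pow, hA, map_one])
  rw [map_ofReal_trace] at hl'
  have hnorm : ‖l‖ = 1 := Complex.norm_eq_one_of_pow_eq_one hl hn.ne'
  have hl0 : l ≠ 0 := norm_ne_zero_iff.1 (by rw [hnorm]; exact one_ne_zero)
  have hconj : (A.1.trace : ℂ) = l + (starRingEnd ℂ) l := by
    have h1 : l * (starRingEnd ℂ) l = 1 := by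
      rw [Complex.mul_conj, Complex.normSq_eq_norm_sq, hnorm]; simp
    apply mul_left_cancel₀ hl0
    linear_combination hl' - h1
  have htr : A.1.trace = 2 * Real.cos l.arg := by
    have h2 := Complex.norm_mul_cos_arg l
    rw [hnorm, one_mul] at h2
    rw [h2]
    rw [Complex.add_conj] at hconj
    exact_mod_cast hconj
  by_cases hs : Real.sin l.arg = 0
  · have hc : Real.cos l.arg ^ 2 = 1 := by
      have := Real.sin_sq_add_cos_sq l.arg
      rw [hs] at this; linarith
    have h3 := eq_scalar_of_pow_eq_one A hn hA hc htr
    refine ⟨1, l.arg / Real.pi, ?_⟩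
    have hπ : Real.pi * (l.arg / Real.pi) = l.arg := by field_simp [Real.pi_ne_zero]
    rw [one_mul, inv_one, mul_one]
    refine Subtype.ext ?_
    rw [h3]
    ext i j
    fin_cases i <;> fin_cases j <;> simp [rotation, hπ, hs]
  -- For a triangular matrix the discriminant of the characteristic polynomial is a square, whereas
  -- here it equals `-4 sin² < 0`.
  · have hr : A.1 1 0 ≠ 0 := by
      intro h0
      have hd := sl2_det A
      rw [Matrix.trace_fin_two] at htr
      have := Real.sin_sq_add_cos_sq l.arg
      have hs2 : 0 < Real.sin l.arg ^ 2 := by positivity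
      rw [h0] at hd
      have h4 : (A.1 0 0 - A.1 1 1) ^ 2 = -4 * Real.sin l.arg ^ 2 := by
        linear_combination (A.1 0 0 + A.1 1 1 + 2 * Real.cos l.arg) * htr - 4 * hd + 4 * this
      linarith [sq_nonneg (A.1 0 0 - A.1 1 1)]
    -- The trace determines the angle only up to sign; the sign is chosen to agree with the
    -- direction of rotation.
    rcases lt_or_gt_of_ne (mul_ne_zero hs hr) with h | h
    · obtain ⟨Q, hQ⟩ := exists_conj_rotation A (θ := -l.arg) (by rw [Real.cos_neg, htr])
        (by rw [Real.sin_neg]; linarith)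
      exact ⟨Q, _, hQ⟩
    · obtain ⟨Q, hQ⟩ := exists_conj_rotation A htr h
      exact ⟨Q, _, hQ⟩

/-- An element of the universal cover with a power equal to an integral translation is conjugate to
a translation. -/
theorem exists_conj_sh_of_pow {φ : UnivPSL} {n : ℕ} (hn : 0 < n) {m : ℤ} (h : φ ^ n = sh m) :
    ∃ P : UnivPSL, φ = P * sh (m / n) * P⁻¹ := by
  -- The exponent is doubled because `sh m` projects to `(-1) ^ m`.
  have h2 : UnivPSL.toSL φ ^ (n * 2) = 1 := by
    rw [← map_pow, pow_mul, h, map_pow, toSL_sh, rotation_int, ← zpow_natCast, ← zpow_mul,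
      mul_comm, zpow_mul]
    simp
  obtain ⟨Q, r, hQ⟩ := exists_conj_rotation_of_pow_eq_one (by omega) h2
  obtain ⟨P, k, hP⟩ := exists_conj_sh hQ
  refine ⟨P, ?_⟩
  have h3 : sh (n * (r + 2 * k)) = sh m := by
    rw [hP, conj_pow, sh_pow, mul_inv_eq_iff_eq_mul, (sh_int_commute m P).eq] at h
    exact mul_left_cancel h
  have h4 := sh_injective h3
  have : (m : ℝ) / n = r + 2 * k := by
    rw [← h4]; field_simp
  rw [this, hP]

theorem trace_toSL_of_pow {φ : UnivPSL} {n : ℕ} (hn : 0 < n) {m : ℤ} (h : φ ^ n = sh m) :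
    (UnivPSL.toSL φ).1.trace = 2 * Real.cos (Real.pi * (m / n)) := by
  obtain ⟨P, hP⟩ := exists_conj_sh_of_pow hn h
  rw [hP, map_mul, map_mul, toSL_sh, Matrix.SpecialLinearGroup.coe_mul, Matrix.trace_mul_comm,
    ← Matrix.SpecialLinearGroup.coe_mul, ← mul_assoc, ← map_mul, inv_mul_cancel, map_one, one_mul,
    Matrix.trace_fin_two]
  simp [rotation]; ring

/-! ### Induced representations -/

section Induced

open scoped commutatorElement

variable {a : Fin 3 → ℕ} {b₀ : ℤ} {b : Fin 3 → ℤ}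

/-- The rational Euler number, multiplied by `a₁ a₂ a₃`. -/
def eulerDegree (a : Fin 3 → ℕ) : EulerGroup a →+ ℤ :=
  QuotientAddGroup.lift _
    (AddMonoidHom.mk' (fun e : ℤ × (Fin 3 → ℤ) => (a 0 : ℤ) * a 1 * a 2 * e.1 +
      e.2 0 * (a 1 * a 2) + e.2 1 * (a 0 * a 2) + e.2 2 * (a 0 * a 1)) (fun e e' => by
        simp only [Prod.fst_add, Prod.snd_add, Pi.add_apply]; ring))
    (by
      rw [AddSubgroup.closure_le]
      rintro _ ⟨i, rfl⟩
      fin_cases i <;> simp <;> ring)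

theorem eulerDegree_eulerClass (β₀ : ℤ) (β : Fin 3 → ℤ) : eulerDegree a (eulerClass a β₀ β) =
    (a 0 : ℤ) * a 1 * a 2 * β₀ + β 0 * (a 1 * a 2) + β 1 * (a 0 * a 2) + β 2 * (a 0 * a 1) := rfl

theorem sh_int_mul_pow (φ : UnivPSL) (c : ℤ) (n : ℕ) :
    (φ * sh c) ^ n = φ ^ n * sh (n * c) := by
  rw [(sh_int_commute c φ).symm.mul_pow, sh_pow]

theorem mul_sh_int_mul (φ ψ χ : UnivPSL) (c d e : ℤ) :
    φ * sh c * (ψ * sh d) * (χ * sh e) = φ * ψ * χ * sh (c + d + e) := by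
  have h1 := (sh_int_commute c (ψ * sh d)).eq
  have h2 := (sh_int_commute d χ).eq
  have h3 := (sh_int_commute c χ).eq
  rw [mul_assoc φ, h1, add_comm (c : ℝ), sh_add, sh_add]
  simp only [mul_assoc]
  rw [← mul_assoc (sh c) χ, h3, ← mul_assoc (sh d), ← mul_assoc (sh d), h2]
  simp only [mul_assoc]

/-- As `p` lies over the identity of the orbifold group, it sends `h` to `h ^ k` and each singular
generator to its namesake times `h ^ cᵢ`. The images in `UnivPSL` turn the relations into linear
equations in `k` and `cᵢ`, and the homology sphere condition solves them for `k`. -/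
theorem IsInducedRep.exists_lift
    (hb : (a 0 : ℤ) * a 1 * a 2 * b₀ + b 0 * (a 1 * a 2) + b 1 * (a 0 * a 2) + b 2 * (a 0 * a 1)
      = 1) {eu : EulerGroup a} {σ : SeifertGroup a b₀ b →* SL2R} (h : IsInducedRep eu σ) :
    ∃ θ : SeifertGroup a b₀ b →* UnivPSL,
      θ (fiber a b₀ b) = sh (eulerDegree a eu) ∧ σ = UnivPSL.toSL.comp θ := by
  obtain ⟨β₀, β, f, Ψ, p, rfl, hp, rfl⟩ := h
  set Ξ : SeifertGroup a β₀ β →* UnivPSL := (pullbackSnd f).comp Ψ.toMulEquiv.toMonoidHom with hΞ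
  have hΞf : Ξ (fiber a β₀ β) = sh 1 := congrArg Prod.snd Ψ.fiber_apply
  have hΞz : ∀ n : ℤ, Ξ (fiber a β₀ β ^ n) = sh n := fun n => by
    rw [map_zpow, hΞf, sh_zpow, mul_one]
  have hover : ∀ g, toOrbifold a β₀ β (p g) = toOrbifold a b₀ b g :=
    DFunLike.congr_fun hp.over_base
  obtain ⟨k, hk⟩ := mem_zpowers_fiber (g := p (fiber a b₀ b)) (by rw [hover, toOrbifold_fiber])
  have hc : ∀ i, ∃ c : ℤ, p (singular a b₀ b i) = singular a β₀ β i * fiber a β₀ β ^ c := by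
    intro i
    obtain ⟨c, hc⟩ := mem_zpowers_fiber
      (g := (singular a β₀ β i)⁻¹ * p (singular a b₀ b i)) (by
        rw [map_mul, hover, map_inv, toOrbifold_singular, toOrbifold_singular, inv_mul_cancel])
    exact ⟨c, by rw [← hc]; group⟩
  choose c hc using hc
  have hθf : Ξ.comp p (fiber a b₀ b) = sh k := by rw [MonoidHom.comp_apply, hk, hΞz]
  have hθs : ∀ i, Ξ.comp p (singular a b₀ b i) = Ξ (singular a β₀ β i) * sh (c i) := fun i => by
    rw [MonoidHom.comp_apply, hc, map_mul, hΞz]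
  have e1 : ∀ i, k * -b i = -β i + a i * c i := by
    intro i
    have h1 := congrArg (Ξ.comp p) (singular_pow (a := a) (b₀ := b₀) (b := b) i)
    rw [map_pow, hθs, sh_int_mul_pow, ← map_pow, singular_pow, hΞz, ← sh_add, map_zpow, hθf,
      sh_zpow] at h1
    have h2 := sh_injective h1
    have : ((-β i + a i * c i : ℤ) : ℝ) = ((-b i * k : ℤ) : ℝ) := by push_cast at h2 ⊢; exact h2
    have := Int.cast_injective this
    linarith
  have e2 : β₀ + c 0 + c 1 + c 2 = k * b₀ := by
    have h1 := congrArg (Ξ.comp p) (singular_prod (a := a) (b₀ := b₀) (b := b))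
    rw [map_mul, map_mul, hθs, hθs, hθs, mul_sh_int_mul, ← map_mul, ← map_mul, singular_prod, hΞz,
      ← sh_add, map_zpow, hθf, sh_zpow] at h1
    have h2 := sh_injective h1
    have : ((β₀ + c 0 + c 1 + c 2 : ℤ) : ℝ) = ((k * b₀ : ℤ) : ℝ) := by
      push_cast; linarith
    exact Int.cast_injective this
  refine ⟨Ξ.comp p, ?_, rfl⟩
  rw [hθf, eulerDegree_eulerClass]
  congr 2
  linear_combination (-k) * hb + (-(a 0 * a 1 * a 2 : ℤ)) * e2 - (a 1 * a 2 : ℤ) * e1 0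
    - (a 0 * a 2 : ℤ) * e1 1 - (a 0 * a 1 : ℤ) * e1 2

/-- A converse to `IsInducedRep.exists_lift`. The equations `hβ` and `hβ₀` say exactly that `h ↦ h ^
k`, `xᵢ ↦ xᵢ h ^ cᵢ` is compatible with the two presentations; this map is `p`, and untwisting `θ`
by the `cᵢ` gives a homomorphism `φ` on the target with `φ ∘ p = θ`. -/
theorem isInducedRep_of_lift
    (hb : (a 0 : ℤ) * a 1 * a 2 * b₀ + b 0 * (a 1 * a 2) + b 1 * (a 0 * a 2) + b 2 * (a 0 * a 1)
      = 1) {θ : SeifertGroup a b₀ b →* UnivPSL} {k β₀ : ℤ} {β c : Fin 3 → ℤ} (hk : k ≠ 0)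
    (hθ : θ (fiber a b₀ b) = sh k) (hβ : ∀ i, β i = a i * c i + k * b i)
    (hβ₀ : β₀ + c 0 + c 1 + c 2 = k * b₀) :
    IsInducedRep (eulerClass a β₀ β) (UnivPSL.toSL.comp θ) := by
  have hθz : ∀ n : ℤ, θ (fiber a b₀ b ^ n) = sh (n * k) := fun n => by
    rw [map_zpow, hθ, sh_zpow]
  obtain ⟨φ, hφf, hφs⟩ := exists_seifertGroup_hom (a := a) (b₀ := β₀) (b := β)
    (fun i => θ (singular a b₀ b i) * sh ((-c i : ℤ) : ℝ)) (sh 1)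
    (fun i => by simpa using sh_int_commute 1 _)
    (fun i => by
      rw [sh_int_mul_pow, ← map_pow, singular_pow, hθz, ← sh_add, sh_zpow, hβ]
      congr 1; push_cast; ring)
    (by
      rw [mul_sh_int_mul, ← map_mul, ← map_mul, singular_prod, hθz, ← sh_add, sh_zpow,
        mul_one]
      congr 1
      have : (b₀ : ℝ) * k = ((k * b₀ : ℤ) : ℝ) := by push_cast; ring
      rw [this, ← hβ₀]; push_cast; ring)
  have hφz : ∀ n : ℤ, φ (fiber a β₀ β ^ n) = sh n := fun n => by
    rw [map_zpow, hφf, sh_zpow, mul_one]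
  obtain ⟨f, hf⟩ := exists_orbifoldGroup_hom (a := a)
    (fun i => UnivPSL.toPSL (φ (singular a β₀ β i)))
    (fun i => by rw [← map_pow, ← map_pow, singular_pow, hφz, toPSL_sh_int])
    (by rw [← map_mul, ← map_mul, ← map_mul, ← map_mul, singular_prod, hφz, toPSL_sh_int])
  have hfφ : f.comp (toOrbifold a β₀ β) = UnivPSL.toPSL.comp φ := by
    refine seifertGroup_hom_ext ?_ fun i => ?_
    · rw [MonoidHom.comp_apply, MonoidHom.comp_apply, toOrbifold_fiber, map_one, hφf]
      simpa using (toPSL_sh_int 1).symm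
    · rw [MonoidHom.comp_apply, MonoidHom.comp_apply, toOrbifold_singular, hf]
  -- The pair (projection, `φ`) identifies the two extensions: both have base `Γ`, and `φ` maps the
  -- powers of the fiber bijectively onto the translations `sh n`.
  let Ψ₀ : SeifertGroup a β₀ β →* pullback f :=
    ((toOrbifold a β₀ β).prod φ).codRestrict (pullback f) (DFunLike.congr_fun hfφ)
  have hinj : Function.Injective Ψ₀ := by
    rw [injective_iff_map_eq_one]
    intro g hg
    have hg' := congrArg Subtype.val hg
    obtain ⟨n, rfl⟩ := mem_zpowers_fiber (congrArg Prod.fst hg')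
    have h2 : φ (fiber a β₀ β ^ n) = 1 := congrArg Prod.snd hg'
    rw [hφz, ← sh_zero] at h2
    have : n = 0 := by exact_mod_cast sh_injective h2
    rw [this, zpow_zero]
  have hsurj : Function.Surjective Ψ₀ := by
    rintro ⟨⟨γ, u⟩, hγ⟩
    obtain ⟨g, rfl⟩ := toOrbifold_surjective (b₀ := β₀) (b := β) γ
    have hγ' : f (toOrbifold a β₀ β g) = UnivPSL.toPSL u := hγ
    obtain ⟨n, hn⟩ := exists_sh_of_toPSL_eq_one (φ := (φ g)⁻¹ * u) (by
      rw [map_mul, map_inv, ← hγ', inv_mul_eq_one]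
      exact (DFunLike.congr_fun hfφ g).symm)
    refine ⟨g * fiber a β₀ β ^ n, Subtype.ext (Prod.ext ?_ ?_)⟩
    · change toOrbifold a β₀ β _ = _
      rw [map_mul, map_zpow, toOrbifold_fiber, one_zpow, mul_one]
    · change φ _ = u
      rw [map_mul, hφz, ← hn, mul_inv_cancel_left]
  let Ψ : EulerIso f β₀ β :=
    { toMulEquiv := MulEquiv.ofBijective Ψ₀ ⟨hinj, hsurj⟩
      fst_apply := fun _ => rfl
      fiber_apply := Prod.ext toOrbifold_fiber hφf }
  have hcomm : ∀ (i : Fin 3) (m : ℤ), Commute (singular a β₀ β i) (fiber a β₀ β ^ m) :=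
    fun i m => ((fiber_commute _).zpow_left m).symm
  obtain ⟨p, hpf, hps⟩ := exists_seifertGroup_hom (a := a) (b₀ := b₀) (b := b)
    (fun i => singular a β₀ β i * fiber a β₀ β ^ c i) (fiber a β₀ β ^ k)
    (fun i => (fiber_commute _).zpow_left k)
    (fun i => by
      rw [(hcomm i (c i)).mul_pow, singular_pow, ← zpow_natCast, ← zpow_mul, ← zpow_add,
        ← zpow_mul, hβ]
      congr 1; ring)
    (by
      have h1 := ((hcomm 1 (c 0)).mul_left (hcomm 2 (c 0)))
      have h2 := hcomm 2 (c 1)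
      calc singular a β₀ β 0 * fiber a β₀ β ^ c 0 * (singular a β₀ β 1 * fiber a β₀ β ^ c 1) *
            (singular a β₀ β 2 * fiber a β₀ β ^ c 2)
          = singular a β₀ β 0 * (fiber a β₀ β ^ c 0 * singular a β₀ β 1) *
            (fiber a β₀ β ^ c 1 * singular a β₀ β 2) * fiber a β₀ β ^ c 2 := by group
        _ = singular a β₀ β 0 * singular a β₀ β 1 * (fiber a β₀ β ^ c 0 * singular a β₀ β 2) *
            fiber a β₀ β ^ c 1 * fiber a β₀ β ^ c 2 := by
            rw [← (hcomm 1 (c 0)).eq, ← (hcomm 2 (c 1)).eq]; group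
        _ = singular a β₀ β 0 * singular a β₀ β 1 * singular a β₀ β 2 *
            (fiber a β₀ β ^ c 0 * fiber a β₀ β ^ c 1 * fiber a β₀ β ^ c 2) := by
            rw [← (hcomm 2 (c 0)).eq]; group
        _ = (fiber a β₀ β ^ k) ^ b₀ := by
            rw [singular_prod, ← zpow_add, ← zpow_add, ← zpow_add, ← zpow_mul, ← hβ₀]
            congr 1; ring)
  have hover : (toOrbifold a β₀ β).comp p = toOrbifold a b₀ b := by
    refine seifertGroup_hom_ext ?_ fun i => ?_
    · rw [MonoidHom.comp_apply, hpf, map_zpow, toOrbifold_fiber, one_zpow, toOrbifold_fiber]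
    · rw [MonoidHom.comp_apply, hps, map_mul, map_zpow, toOrbifold_fiber, one_zpow, mul_one,
        toOrbifold_singular, toOrbifold_singular]
  have hφp : φ.comp p = θ := by
    refine seifertGroup_hom_ext ?_ fun i => ?_
    · rw [MonoidHom.comp_apply, hpf, hφz, hθ]
    · rw [MonoidHom.comp_apply, hps, map_mul, hφz, hφs, mul_assoc, ← sh_add]
      simp
  refine ⟨β₀, β, f, Ψ, p, rfl, ⟨?_, ?_, hover⟩, ?_⟩
  -- The kernel of `p` consists of powers of the fiber, and `θ` sends `h ^ n` to `sh (n * k)`, which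
  -- is trivial only for `n = 0` because `k ≠ 0`.
  · rw [injective_iff_map_eq_one]
    intro g hg
    obtain ⟨n, rfl⟩ := mem_zpowers_fiber (g := g) (by
      rw [← hover, MonoidHom.comp_apply, hg, map_one])
    have h1 := DFunLike.congr_fun hφp (fiber a b₀ b ^ n)
    rw [MonoidHom.comp_apply, hg, map_one, hθz, ← sh_zero] at h1
    have h2 : (n : ℝ) * k = 0 := (sh_injective h1).symm
    have : n = 0 := by
      have h3 : n * k = 0 := by exact_mod_cast h2
      exact (mul_eq_zero.1 h3).resolve_right hk
    rw [this, zpow_zero]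
  -- The source is perfect, so its image consists of products of commutators. Conversely every
  -- element of the target is a central power of the fiber times an element of the image, so
  -- commutators come from the source.
  · apply le_antisymm
    · rw [MonoidHom.range_eq_map, ← commutator_seifertGroup hb, map_commutator_eq]
      exact Subgroup.commutator_mono le_top le_top
    · rw [commutator_def, Subgroup.commutator_le]
      have hdec : ∀ g : SeifertGroup a β₀ β, ∃ (g' : SeifertGroup a b₀ b) (n : ℤ),
          g = fiber a β₀ β ^ n * p g' := fun g => by
        obtain ⟨g', hg'⟩ := toOrbifold_surjective (b₀ := b₀) (b := b) (toOrbifold a β₀ β g)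
        obtain ⟨n, hn⟩ := mem_zpowers_fiber (g := g * (p g')⁻¹) (by
          rw [map_mul, map_inv, ← hg', ← hover, MonoidHom.comp_apply, mul_inv_cancel])
        exact ⟨g', n, by rw [← hn, inv_mul_cancel_right]⟩
      intro g₁ _ g₂ _
      obtain ⟨g₁, m, rfl⟩ := hdec g₁
      obtain ⟨g₂, n, rfl⟩ := hdec g₂
      have hz : ∀ (m : ℤ) (g : SeifertGroup a β₀ β), Commute (fiber a β₀ β ^ m) g :=
        fun m g => (fiber_commute g).zpow_left m
      have : ⁅fiber a β₀ β ^ m * p g₁, fiber a β₀ β ^ n * p g₂⁆ = p ⁅g₁, g₂⁆ := by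
        rw [map_commutatorElement, commutatorElement_def, commutatorElement_def]
        generalize hu : fiber a β₀ β ^ m = u
        generalize hv : fiber a β₀ β ^ n = v
        have hu' : ∀ g, u * g = g * u := fun g => by rw [← hu]; exact (hz m g).eq
        have hv' : ∀ g, v * g = g * v := fun g => by rw [← hv]; exact (hz n g).eq
        rw [mul_inv_rev, mul_inv_rev, hu' (p g₁), hv' (p g₂)]
        calc p g₁ * u * (p g₂ * v) * ((p g₁)⁻¹ * u⁻¹) * ((p g₂)⁻¹ * v⁻¹)
            = p g₁ * (u * (p g₂ * v * (p g₁)⁻¹)) * u⁻¹ * (p g₂)⁻¹ * v⁻¹ := by group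
          _ = p g₁ * p g₂ * (v * ((p g₁)⁻¹ * (p g₂)⁻¹)) * v⁻¹ := by rw [hu']; group
          _ = p g₁ * p g₂ * (p g₁)⁻¹ * (p g₂)⁻¹ := by rw [hv']; group
      rw [this]
      exact ⟨_, rfl⟩
  · rw [← hφp]; rfl

end Induced

/-! ### Hyperbolic triangles -/

/-- `P` is increasing and commutes with `sh 1`, so strict bounds on displacement by integers survive
conjugation. This identifies which lift of a product occurs in `exists_triangle`. -/
theorem conj_sh_neg_apply_mem {r : ℝ} (h0 : 0 < r) (h1 : r < 1) (P : UnivPSL) (t : ℝ) :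
    t - 1 < ((P * sh (-r) * P⁻¹ : UnivPSL) : ℝ ≃ₜ ℝ) t ∧
      ((P * sh (-r) * P⁻¹ : UnivPSL) : ℝ ≃ₜ ℝ) t < t := by
  set s := ((P⁻¹ : UnivPSL) : ℝ ≃ₜ ℝ) t with hs
  have ht : (P : ℝ ≃ₜ ℝ) s = t := (P : ℝ ≃ₜ ℝ).apply_symm_apply t
  have e : ((P * sh (-r) * P⁻¹ : UnivPSL) : ℝ ≃ₜ ℝ) t = (P : ℝ ≃ₜ ℝ) (s + -r) := rfl
  have h2 := univPSL_add_one P (s - 1)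
  rw [sub_add_cancel, ht] at h2
  rw [e]
  constructor
  · rw [h2, add_sub_cancel_right]
    exact univPSL_strictMono P (by linarith)
  · calc (P : ℝ ≃ₜ ℝ) (s + -r) < (P : ℝ ≃ₜ ℝ) s := univPSL_strictMono P (by linarith)
      _ = t := ht

/-- The diagonal matrix with entries `d` and `d⁻¹`. -/
noncomputable def diagSL (d : ℝ) (hd : d ≠ 0) : SL2R :=
  ⟨!![d, 0; 0, d⁻¹], by rw [Matrix.det_fin_two_of]; field_simp; ring⟩

theorem exists_add_inv_eq {w : ℝ} (hw : 2 < w) : ∃ u : ℝ, 1 ≤ u ∧ u + u⁻¹ = w := by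
  have h1 : 0 ≤ w ^ 2 - 4 := by nlinarith
  refine ⟨(w + √(w ^ 2 - 4)) / 2, by linarith [Real.sqrt_nonneg (w ^ 2 - 4)], ?_⟩
  have h2 := Real.sq_sqrt h1
  have h3 : 0 < w + √(w ^ 2 - 4) := by linarith [Real.sqrt_nonneg (w ^ 2 - 4)]
  field_simp
  linear_combination h2

/-- Two rotations, by angles with sum less than `π`, about points at a suitable distance have a
product which is elliptic with prescribed angle. -/
theorem exists_rotation_mul_conj {A B C : ℝ} (hA : 0 < A) (hB : 0 < B) (hC : 0 < C)
    (h : A + B + C < Real.pi) :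
    ∃ D : SL2R, (rotation (-(A / Real.pi)) * (D * rotation (-(B / Real.pi)) * D⁻¹)).1.trace =
        2 * Real.cos (C - Real.pi) ∧
      (rotation (-(A / Real.pi)) * (D * rotation (-(B / Real.pi)) * D⁻¹)).1 1 0 < 0 := by
  have sA : 0 < Real.sin A := Real.sin_pos_of_pos_of_lt_pi hA (by linarith)
  have sB : 0 < Real.sin B := Real.sin_pos_of_pos_of_lt_pi hB (by linarith)
  have sC : 0 < Real.sin C := Real.sin_pos_of_pos_of_lt_pi hC (by linarith)
  have sAB : 0 < Real.sin (A + B) := Real.sin_pos_of_pos_of_lt_pi (by linarith) (by linarith)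
  have cAB : -Real.cos C < Real.cos (A + B) := by
    rw [← Real.cos_pi_sub]
    exact Real.strictAntiOn_cos ⟨by linarith, by linarith⟩ ⟨by linarith, by linarith⟩ (by linarith)
  rw [Real.sin_add] at sAB
  rw [Real.cos_add] at cAB
  -- The hyperbolic law of cosines: `u` is the exponential of the side joining the vertices with
  -- angles `A` and `B`, so `w = 2 cosh` of that side. The condition `2 < w` is `cos(A+B) > -cos C`.
  obtain ⟨u, hu1, hu⟩ := exists_add_inv_eq
    (w := 2 * (Real.cos A * Real.cos B + Real.cos C) / (Real.sin A * Real.sin B)) (by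
      rw [lt_div_iff₀ (mul_pos sA sB)]; linarith)
  have hu0 : 0 < u := by linarith
  have huw : (u + u⁻¹) * (Real.sin A * Real.sin B) =
      2 * (Real.cos A * Real.cos B + Real.cos C) := by
    rw [hu]; field_simp
  have hd : √u ≠ 0 := (Real.sqrt_pos.2 hu0).ne'
  have hdd : √u * √u = u := Real.mul_self_sqrt hu0.le
  have hdd' : (√u)⁻¹ * (√u)⁻¹ = u⁻¹ := by rw [← mul_inv, hdd]
  have hA' : Real.pi * (A / Real.pi) = A := by field_simp
  have hB' : Real.pi * (B / Real.pi) = B := by field_simp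
  set W : SL2R := rotation (-(A / Real.pi)) *
    (diagSL (√u) hd * rotation (-(B / Real.pi)) * (diagSL (√u) hd)⁻¹) with hW
  have hWm : W.1 = !![Real.cos A, Real.sin A; -Real.sin A, Real.cos A] *
      !![Real.cos B, u * Real.sin B; -(u⁻¹ * Real.sin B), Real.cos B] := by
    rw [hW, Matrix.SpecialLinearGroup.coe_mul, Matrix.SpecialLinearGroup.coe_mul,
      Matrix.SpecialLinearGroup.coe_mul, Matrix.SpecialLinearGroup.coe_inv]
    congr 1
    · simp [rotation, hA']
    · ext i j
      fin_cases i <;> fin_cases j <;>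
        simp [diagSL, rotation, Matrix.mul_apply, Fin.sum_univ_two, Matrix.adjugate_fin_two, hB']
      · field_simp
      · linear_combination Real.sin B * hdd
      · linear_combination Real.sin B * hdd'
      · field_simp
  have w00 : W.1 0 0 = Real.cos A * Real.cos B - u⁻¹ * Real.sin A * Real.sin B := by
    rw [hWm]; simp [Matrix.mul_apply, Fin.sum_univ_two]; ring
  have w11 : W.1 1 1 = Real.cos A * Real.cos B - u * Real.sin A * Real.sin B := by
    rw [hWm]; simp [Matrix.mul_apply, Fin.sum_univ_two]; ring
  have w01 : W.1 0 1 = u * (Real.cos A * Real.sin B) + Real.sin A * Real.cos B := by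
    rw [hWm]; simp [Matrix.mul_apply, Fin.sum_univ_two]; ring
  have w10 : W.1 1 0 = -(Real.sin A * Real.cos B + u⁻¹ * (Real.cos A * Real.sin B)) := by
    rw [hWm]; simp [Matrix.mul_apply, Fin.sum_univ_two]; ring
  have htr : W.1 0 0 + W.1 1 1 = -2 * Real.cos C := by
    rw [w00, w11]; linear_combination -huw
  refine ⟨diagSL (√u) hd, ?_, ?_⟩
  · rw [← hW, Matrix.trace_fin_two, htr, Real.cos_sub_pi]; ring
  · rw [← hW]
    have hdet := sl2_det W
    -- `W` is elliptic, so its off-diagonal entries have opposite signs. According to the sign of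
    -- `cos A`, one of them is bounded by comparison with `sin(A+B)`, using `1 ≤ u`.
    have hneg : W.1 0 1 * W.1 1 0 < 0 := by
      have h1 := Real.sin_sq_add_cos_sq C
      have h2 : 0 < Real.sin C ^ 2 := by positivity
      have h3 : (W.1 0 0 + W.1 1 1) ^ 2 = 4 * Real.cos C ^ 2 := by rw [htr]; ring
      nlinarith [sq_nonneg (W.1 0 0 - W.1 1 1)]
    rcases le_or_gt 0 (Real.cos A) with hc | hc
    · have : 0 < W.1 0 1 := by
        rw [w01]
        nlinarith [mul_nonneg (sub_nonneg.2 hu1) (mul_nonneg hc sB.le)]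
      nlinarith
    · have hu' : u⁻¹ ≤ 1 := inv_le_one_of_one_le₀ hu1
      rw [w10]
      nlinarith [mul_nonneg (sub_nonneg.2 hu') (mul_nonneg (neg_nonneg.2 hc.le) sB.le)]

theorem exists_triangle {r : Fin 3 → ℝ} (hr : ∀ i, 0 < r i) (hsum : r 0 + r 1 + r 2 < 1) :
    ∃ X : Fin 3 → UnivPSL, (∀ i, ∃ P, X i = P * sh (-r i) * P⁻¹) ∧
      X 0 * X 1 * X 2 = sh (-1) := by
  have hπ := Real.pi_pos
  have hr0 := hr 0
  have hr1 := hr 1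
  have hr2 := hr 2
  have hdiv : ∀ i, Real.pi * r i / Real.pi = r i := fun i => by field_simp
  obtain ⟨D, ht, hn⟩ := exists_rotation_mul_conj (mul_pos hπ hr0) (mul_pos hπ hr1)
    (mul_pos hπ hr2) (by nlinarith)
  rw [hdiv, hdiv] at ht hn
  obtain ⟨Q, hQ⟩ := exists_conj_rotation _ ht (mul_pos_of_neg_of_neg (by
    rw [Real.sin_sub_pi, neg_lt_zero]
    exact Real.sin_pos_of_pos_of_lt_pi (mul_pos hπ hr2) (by nlinarith)) hn)
  obtain ⟨R, hR, -⟩ := exists_toSL_eq D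
  obtain ⟨P, n, hP⟩ := exists_conj_sh (φ := sh (-r 0) * (R * sh (-r 1) * R⁻¹)) (by
    rw [map_mul, map_mul, map_mul, map_inv, toSL_sh, toSL_sh, hR, hQ])
  have hang : (Real.pi * r 2 - Real.pi) / Real.pi = r 2 - 1 := by field_simp
  rw [hang] at hP
  -- The product moves `t` to the left by an amount strictly between `0` and `2`, so `-2 < r 2 - 1 +
  -- 2n < 0`.
  have hn0 : n = 0 := by
    set t := (P : ℝ ≃ₜ ℝ) 0 with ht0
    have h1 := conj_sh_neg_apply_mem hr1 (by linarith) R t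
    have hPinv : ((P⁻¹ : UnivPSL) : ℝ ≃ₜ ℝ) t = 0 := (P : ℝ ≃ₜ ℝ).symm_apply_apply 0
    have h2 : ((P * sh (r 2 - 1 + 2 * n) * P⁻¹ : UnivPSL) : ℝ ≃ₜ ℝ) t =
        (P : ℝ ≃ₜ ℝ) (r 2 - 1 + 2 * n) := by
      rw [univPSL_mul_apply, univPSL_mul_apply, hPinv, sh_apply, zero_add]
    rw [← hP, univPSL_mul_apply, sh_apply] at h2
    have h3 := univPSL_add_one P (-2)
    have h4 := univPSL_add_one P (-1)
    norm_num at h3 h4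
    have h5 : (P : ℝ ≃ₜ ℝ) (r 2 - 1 + 2 * n) < (P : ℝ ≃ₜ ℝ) 0 := by rw [← h2, ← ht0]; linarith
    have h6 : (P : ℝ ≃ₜ ℝ) (-2) < (P : ℝ ≃ₜ ℝ) (r 2 - 1 + 2 * n) := by
      rw [← h2]; linarith
    rw [(univPSL_strictMono P).lt_iff_lt] at h5 h6
    have h7 : (-1 : ℝ) < n := by linarith
    have h8 : (n : ℝ) < 1 := by linarith
    have h7' : -1 < n := by exact_mod_cast h7
    have h8' : n < 1 := by exact_mod_cast h8
    omega
  rw [hn0, Int.cast_zero, mul_zero, add_zero] at hP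
  refine ⟨![sh (-r 0), R * sh (-r 1) * R⁻¹, P * sh (-r 2) * P⁻¹], fun i => ?_, ?_⟩
  · fin_cases i
    · exact ⟨1, by simp⟩
    · exact ⟨R, rfl⟩
    · exact ⟨P, rfl⟩
  · change sh (-r 0) * (R * sh (-r 1) * R⁻¹) * (P * sh (-r 2) * P⁻¹) = sh (-1)
    have hc := sh_int_commute (-1) P
    rw [Int.cast_neg, Int.cast_one] at hc
    calc _ = P * (sh (r 2 - 1) * sh (-r 2)) * P⁻¹ := by rw [hP]; group
      _ = sh (-1) := by
        rw [← sh_add, show r 2 - 1 + -r 2 = -1 by ring, ← hc.eq, mul_inv_cancel_right]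

/-! ### Pairs of matrices in `SL(2; ℂ)` -/

/-- The two matrices have an eigenvector in common. -/
def HasCommonEigenvector (X Y : SL2C) : Prop :=
  ∃ v : Fin 2 → ℂ, v ≠ 0 ∧ (∃ l : ℂ, X.1.mulVec v = l • v) ∧ ∃ m : ℂ, Y.1.mulVec v = m • v

/-- The trace of the commutator of a pair of matrices in `SL(2)`, minus `2`, in terms of the traces
of the matrices and of their product. -/
def fricke {K : Type*} [CommRing K] (x y t : K) : K := x ^ 2 + y ^ 2 + t ^ 2 - x * y * t - 4

theorem adjugate_eq_trace_sub {K : Type*} [CommRing K] (M : Matrix (Fin 2) (Fin 2) K) :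
    M.adjugate = M.trace • (1 : Matrix (Fin 2) (Fin 2) K) - M := by
  rw [Matrix.adjugate_fin_two, Matrix.trace_fin_two]
  ext i j
  fin_cases i <;> fin_cases j <;> simp

/-- Apply `(XY)⁻¹ = Y⁻¹X⁻¹` to `v`, writing each inverse as trace minus matrix. Together with
`mulVec_mulVec_self` this expresses both matrices in the basis `v`, `Yv` through `l` and the three
traces. -/
theorem mulVec_mulVec_of_eigenvector (X Y : SL2C) {l : ℂ} {v : Fin 2 → ℂ}
    (h : X.1.mulVec v = l • v) : X.1.mulVec (Y.1.mulVec v) =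
      ((X * Y).1.trace - Y.1.trace * (X.1.trace - l)) • v +
        (X.1.trace - l) • Y.1.mulVec v := by
  have h1 : X.1.adjugate.mulVec v = (X.1.trace - l) • v := by
    rw [adjugate_eq_trace_sub, Matrix.sub_mulVec, Matrix.smul_mulVec, Matrix.one_mulVec, h,
      sub_smul]
  have h2 : (X * Y).1.adjugate.mulVec v =
      (X.1.trace - l) • (Y.1.trace • v - Y.1.mulVec v) := by
    rw [Matrix.SpecialLinearGroup.coe_mul, Matrix.adjugate_mul_distrib, ← Matrix.mulVec_mulVec, h1,
      Matrix.mulVec_smul, adjugate_eq_trace_sub Y.1, Matrix.sub_mulVec, Matrix.smul_mulVec,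
      Matrix.one_mulVec]
  rw [adjugate_eq_trace_sub, Matrix.sub_mulVec, Matrix.smul_mulVec, Matrix.one_mulVec,
    Matrix.SpecialLinearGroup.coe_mul, ← Matrix.mulVec_mulVec,
    ← Matrix.SpecialLinearGroup.coe_mul] at h2
  rw [sub_eq_iff_eq_add] at h2
  rw [eq_sub_of_add_eq' h2.symm]
  module

theorem mulVec_mulVec_self (Y : SL2C) (v : Fin 2 → ℂ) :
    Y.1.mulVec (Y.1.mulVec v) = -v + Y.1.trace • Y.1.mulVec v := by
  have h : Y.1 * Y.1.adjugate = 1 := by rw [Matrix.mul_adjugate, Y.2, one_smul]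
  have h1 := congrArg (fun M => Matrix.mulVec M v) h
  simp only [← Matrix.mulVec_mulVec, Matrix.one_mulVec] at h1
  rw [adjugate_eq_trace_sub, Matrix.sub_mulVec, Matrix.smul_mulVec, Matrix.one_mulVec,
    Matrix.mulVec_sub, Matrix.mulVec_smul] at h1
  exact (neg_add_eq_of_eq_add (sub_eq_iff_eq_add.1 h1)).symm

/-- First matrix of the normal form of an irreducible pair with traces `x`, `y`, `t`. -/
def normalFormFst (x y t l : ℂ) (h : l * (x - l) = 1) : SL2C :=
  ⟨!![l, t - y * (x - l); 0, x - l], by rw [Matrix.det_fin_two_of]; linear_combination h⟩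

/-- Second matrix of the normal form of an irreducible pair. -/
def normalFormSnd (y : ℂ) : SL2C := ⟨!![0, -1; 1, y], by rw [Matrix.det_fin_two_of]; ring⟩

theorem exists_normalForm {X Y : SL2C} (hXY : ¬ HasCommonEigenvector X Y) {l : ℂ}
    (hl : l * (X.1.trace - l) = 1) :
    ∃ R : SL2C, X = R * normalFormFst X.1.trace Y.1.trace (X * Y).1.trace l hl * R⁻¹ ∧
      Y = R * normalFormSnd Y.1.trace * R⁻¹ := by
  have hd := sl2_det X
  obtain ⟨v, hv, hXv⟩ : ∃ v : Fin 2 → ℂ, v ≠ 0 ∧ X.1.mulVec v = l • v := by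
    obtain ⟨v, hv, h⟩ := (Matrix.exists_mulVec_eq_zero_iff
      (M := X.1 - l • (1 : Matrix (Fin 2) (Fin 2) ℂ))).2 (by
        rw [Matrix.trace_fin_two] at hl
        rw [Matrix.det_fin_two]
        simp
        linear_combination hd - hl)
    rw [Matrix.sub_mulVec, Matrix.smul_mulVec, Matrix.one_mulVec, sub_eq_zero] at h
    exact ⟨v, hv, h⟩
  set w := Y.1.mulVec v with hw
  have hXw := mulVec_mulVec_of_eigenvector X Y hXv
  have hYw := mulVec_mulVec_self Y v
  rw [← hw] at hXw hYw
  -- If `v` and `Yv` were dependent, `v` would be a common eigenvector.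
  have hdet : v 0 * w 1 - w 0 * v 1 ≠ 0 := by
    intro h0
    refine hXY ⟨v, hv, ⟨l, hXv⟩, ?_⟩
    rw [← hw]
    by_cases hv0 : v 0 = 0
    · have hv1 : v 1 ≠ 0 := fun h1 => hv (by ext i; fin_cases i <;> assumption)
      refine ⟨w 1 / v 1, ?_⟩
      ext i; fin_cases i
      · simp; field_simp; linear_combination -h0
      · simp; field_simp
    · refine ⟨w 0 / v 0, ?_⟩
      ext i; fin_cases i
      · simp; field_simp
      · simp; field_simp; linear_combination h0
  -- Rescaling the basis `v`, `Yv` by `k` gives determinant `1`.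
  obtain ⟨k, hk⟩ := IsAlgClosed.exists_pow_nat_eq (v 0 * w 1 - w 0 * v 1)⁻¹ (n := 2) (by norm_num)
  let R : SL2C := ⟨!![k * v 0, k * w 0; k * v 1, k * w 1], by
    rw [Matrix.det_fin_two_of]
    have : k ^ 2 * (v 0 * w 1 - w 0 * v 1) = 1 := by rw [hk, inv_mul_cancel₀ hdet]
    linear_combination this⟩
  have a0 := congrFun hXv 0
  have a1 := congrFun hXv 1
  have b0 := congrFun hXw 0
  have b1 := congrFun hXw 1
  have c0 := congrFun hYw 0
  have c1 := congrFun hYw 1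
  have d0 := congrFun hw 0
  have d1 := congrFun hw 1
  simp only [Matrix.mulVec, dotProduct, Fin.sum_univ_two, Pi.smul_apply, Pi.add_apply,
    Pi.neg_apply, smul_eq_mul] at a0 a1 b0 b1 c0 c1 d0 d1
  refine ⟨R, eq_mul_inv_of_mul_eq (Subtype.ext ?_), eq_mul_inv_of_mul_eq (Subtype.ext ?_)⟩
  · generalize (X * Y).1.trace = t at *
    generalize X.1.trace = x at *
    generalize Y.1.trace = y at *
    rw [Matrix.SpecialLinearGroup.coe_mul, Matrix.SpecialLinearGroup.coe_mul]
    ext i j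
    fin_cases i <;> fin_cases j <;>
      simp [R, normalFormFst, Matrix.mul_apply, Fin.sum_univ_two]
    · linear_combination k * a0
    · linear_combination k * b0
    · linear_combination k * a1
    · linear_combination k * b1
  · generalize (X * Y).1.trace = t at *
    generalize X.1.trace = x at *
    generalize Y.1.trace = y at *
    rw [Matrix.SpecialLinearGroup.coe_mul, Matrix.SpecialLinearGroup.coe_mul]
    ext i j
    fin_cases i <;> fin_cases j <;>
      simp [R, normalFormSnd, Matrix.mul_apply, Fin.sum_univ_two]
    · linear_combination -k * d0
    · linear_combination k * c0
    · linear_combination -k * d1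
    · linear_combination k * c1

/-- Irreducible pairs with the same traces are conjugate. -/
theorem exists_conj_of_trace_eq {X Y X' Y' : SL2C} (h : ¬ HasCommonEigenvector X Y)
    (h' : ¬ HasCommonEigenvector X' Y') (hx : X'.1.trace = X.1.trace)
    (hy : Y'.1.trace = Y.1.trace) (ht : (X' * Y').1.trace = (X * Y).1.trace) :
    ∃ P : SL2C, X' = P * X * P⁻¹ ∧ Y' = P * Y * P⁻¹ := by
  obtain ⟨l, v, hv, hlv⟩ := exists_eigenvector X.1
  have hl := eigenvalue_eq X hv hlv
  obtain ⟨R, hX, hY⟩ := exists_normalForm h hl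
  have hl' : l * (X'.1.trace - l) = 1 := by rw [hx]; exact hl
  obtain ⟨R', hX', hY'⟩ := exists_normalForm h' hl'
  simp only [hx, hy, ht] at hX' hY'
  refine ⟨R' * R⁻¹, ?_, ?_⟩
  · generalize normalFormFst X.1.trace Y.1.trace (X * Y).1.trace l hl = N at *
    rw [hX', hX]; group
  · generalize normalFormSnd Y.1.trace = N at *
    rw [hY', hY]; group

/-- On a common eigenvector the eigenvalues multiply, and `fricke` vanishes identically at `l +
l⁻¹`, `m + m⁻¹`, `lm + (lm)⁻¹`. -/
theorem not_hasCommonEigenvector_of_fricke_ne_zero {X Y : SL2C}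
    (h : fricke X.1.trace Y.1.trace (X * Y).1.trace ≠ 0) : ¬ HasCommonEigenvector X Y := by
  rintro ⟨v, hv, ⟨l, hl⟩, m, hm⟩
  have h1 := eigenvalue_eq X hv hl
  have h2 := eigenvalue_eq Y hv hm
  have h3 := eigenvalue_eq (X * Y) (l := l * m) hv (by
    rw [Matrix.SpecialLinearGroup.coe_mul, ← Matrix.mulVec_mulVec, hm, Matrix.mulVec_smul, hl,
      smul_smul, mul_comm])
  have hl0 : l ≠ 0 := by rintro rfl; simp at h1
  have hm0 : m ≠ 0 := by rintro rfl; simp at h2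
  have e1 : X.1.trace = l + l⁻¹ := by field_simp; linear_combination h1
  have e2 : Y.1.trace = m + m⁻¹ := by field_simp; linear_combination h2
  have e3 : (X * Y).1.trace = l * m + (l * m)⁻¹ := by field_simp; linear_combination h3
  apply h
  rw [e1, e2, e3, fricke]
  field_simp
  ring

/-- In the normal form `w` is the eigenvector of the first matrix for its other eigenvalue `x - l`,
and vanishing of `fricke` says that the second matrix preserves the line of `w`. Distinctness of the
eigenvalues makes `w` nonzero. -/
theorem fricke_ne_zero_of_not_hasCommonEigenvector {X Y : SL2C}
    (h : ¬ HasCommonEigenvector X Y) {l : ℂ} (hl : l * (X.1.trace - l) = 1)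
    (hne : X.1.trace - l ≠ l) : fricke X.1.trace Y.1.trace (X * Y).1.trace ≠ 0 := by
  intro h0
  obtain ⟨R, hX, hY⟩ := exists_normalForm h hl
  set x := X.1.trace
  set y := Y.1.trace
  set t := (X * Y).1.trace
  have hδ : x - l - l ≠ 0 := sub_ne_zero.2 hne
  set s := t - y * (x - l) with hs
  set w : Fin 2 → ℂ := ![s, x - l - l] with hw
  have hw0 : w ≠ 0 := fun h => hδ (congrFun h 1)
  have hRw : ∀ (N : SL2C) (m : ℂ), N.1.mulVec w = m • w →
      (R * N * R⁻¹).1.mulVec (R.1.mulVec w) = m • R.1.mulVec w := by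
    intro N m hN
    rw [Matrix.mulVec_mulVec, ← Matrix.SpecialLinearGroup.coe_mul, inv_mul_cancel_right,
      Matrix.SpecialLinearGroup.coe_mul, ← Matrix.mulVec_mulVec, hN, Matrix.mulVec_smul]
  refine h ⟨R.1.mulVec w, ?_, ⟨x - l, ?_⟩, ⟨(s + y * (x - l - l)) / (x - l - l), ?_⟩⟩
  · intro h1
    apply hw0
    have h2 := congrArg ((R⁻¹).1.mulVec) h1
    rwa [Matrix.mulVec_mulVec, ← Matrix.SpecialLinearGroup.coe_mul, inv_mul_cancel,
      Matrix.SpecialLinearGroup.coe_one, Matrix.one_mulVec, Matrix.mulVec_zero] at h2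
  · rw [hX]
    apply hRw
    ext i; fin_cases i <;>
      simp [normalFormFst, Matrix.mulVec, dotProduct, Fin.sum_univ_two, hw]
    · rw [← hs]; ring
    · exact Or.inl rfl
  · rw [hY]
    apply hRw
    ext i; fin_cases i <;>
      simp [normalFormSnd, Matrix.mulVec, dotProduct, Fin.sum_univ_two, hw] <;> field_simp
    rw [fricke] at h0
    rw [hs]
    linear_combination (-1 : ℂ) * h0 - (y ^ 2 - 4) * hl

/-- A pair with negative Fricke polynomial is conjugate into `SU(2)`. -/
theorem exists_conj_specialUnitary {X Y : SL2C} {A y t : ℝ} (hA : Real.sin A ≠ 0)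
    (hx : X.1.trace = ((2 * Real.cos A : ℝ) : ℂ)) (hy : Y.1.trace = y) (ht : (X * Y).1.trace = t)
    (hneg : fricke (2 * Real.cos A) y t < 0) :
    ∃ P : SL2C, (P * X * P⁻¹).1 ∈ Matrix.specialUnitaryGroup (Fin 2) ℂ ∧
      (P * Y * P⁻¹).1 ∈ Matrix.specialUnitaryGroup (Fin 2) ℂ := by
  obtain ⟨e, rfl⟩ : ∃ e, y = 2 * e := ⟨y / 2, by ring⟩
  have hcs := Real.sin_sq_add_cos_sq A
  set c := Real.cos A
  set s := Real.sin A
  have hs2 : 0 < s ^ 2 := by positivity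
  -- The model pair is `diag(c + is, c - is)` and the unitary matrix with rows `(e + im, q)`, `(-q,
  -- e - im)`. The trace of the product forces `m`, and `q² = 1 - e² - m²` equals `-fricke / (4s²)`,
  -- positive by hypothesis.
  set m := (c * (2 * e) - t) / (2 * s) with hm
  have hms : 2 * s * m = c * (2 * e) - t := by rw [hm]; field_simp
  have hq : 0 ≤ 1 - e ^ 2 - m ^ 2 := by
    have h1 : 0 < 4 * s ^ 2 * (1 - e ^ 2 - m ^ 2) := by
      have : 4 * s ^ 2 * (1 - e ^ 2 - m ^ 2) = -fricke (2 * c) (2 * e) t := by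
        rw [fricke]
        linear_combination (4 - 4 * e ^ 2) * hcs - (2 * s * m + (c * (2 * e) - t)) * hms
      linarith
    exact (pos_of_mul_pos_right h1 (by positivity)).le
  set q := √(1 - e ^ 2 - m ^ 2) with hqd
  have hqq : q ^ 2 = 1 - e ^ 2 - m ^ 2 := Real.sq_sqrt hq
  have hcsC : (c : ℂ) ^ 2 + (s : ℂ) ^ 2 = 1 := by exact_mod_cast (add_comm _ _).trans hcs
  have hqC : (q : ℂ) ^ 2 + (e : ℂ) ^ 2 + (m : ℂ) ^ 2 = 1 := by
    have : q ^ 2 + e ^ 2 + m ^ 2 = 1 := by rw [hqq]; ring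
    exact_mod_cast this
  have hmsC : 2 * (s : ℂ) * m = c * (2 * e) - t := by exact_mod_cast hms
  let X' : SL2C := ⟨!![(c : ℂ) + s * Complex.I, 0; 0, (c : ℂ) - s * Complex.I], by
    rw [Matrix.det_fin_two_of]
    linear_combination hcsC - s ^ 2 * Complex.I_sq⟩
  let Y' : SL2C := ⟨!![(e : ℂ) + m * Complex.I, q; -q, (e : ℂ) - m * Complex.I], by
    rw [Matrix.det_fin_two_of]
    linear_combination hqC - m ^ 2 * Complex.I_sq⟩
  have tX : X'.1.trace = ((2 * c : ℝ) : ℂ) := by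
    rw [Matrix.trace_fin_two]; simp [X']; ring
  have tY : Y'.1.trace = ((2 * e : ℝ) : ℂ) := by rw [Matrix.trace_fin_two]; simp [Y']; ring
  have tXY : (X' * Y').1.trace = t := by
    rw [Matrix.SpecialLinearGroup.coe_mul, Matrix.trace_fin_two]
    simp [X', Y', Matrix.mul_apply, Fin.sum_univ_two]
    linear_combination (2 * s * m) * Complex.I_sq - hmsC
  have hf : fricke ((2 * c : ℝ) : ℂ) ((2 * e : ℝ) : ℂ) (t : ℂ) ≠ 0 := by
    have : fricke ((2 * c : ℝ) : ℂ) ((2 * e : ℝ) : ℂ) (t : ℂ) = ((fricke (2 * c) (2 * e) t : ℝ) : ℂ) := by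
      simp only [fricke]; push_cast; ring
    rw [this]
    exact_mod_cast hneg.ne
  obtain ⟨P, h1, h2⟩ := exists_conj_of_trace_eq
    (not_hasCommonEigenvector_of_fricke_ne_zero (X := X) (Y := Y) (by rwa [hx, hy, ht]))
    (not_hasCommonEigenvector_of_fricke_ne_zero (X := X') (Y := Y') (by rwa [tX, tY, tXY]))
    (tX.trans hx.symm) (tY.trans hy.symm) (tXY.trans ht.symm)
  refine ⟨P, ?_, ?_⟩
  · rw [← h1, Matrix.mem_specialUnitaryGroup_iff, Matrix.mem_unitaryGroup_iff]
    refine ⟨?_, X'.2⟩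
    ext i j
    fin_cases i <;> fin_cases j <;>
      simp [X', Matrix.mul_apply, Fin.sum_univ_two, Matrix.star_apply]
    · linear_combination hcsC - s ^ 2 * Complex.I_sq
    · linear_combination hcsC - s ^ 2 * Complex.I_sq
  · rw [← h2, Matrix.mem_specialUnitaryGroup_iff, Matrix.mem_unitaryGroup_iff]
    refine ⟨?_, Y'.2⟩
    ext i j
    fin_cases i <;> fin_cases j <;>
      simp [Y', Matrix.mul_apply, Fin.sum_univ_two, Matrix.star_apply]
    · linear_combination hqC - m ^ 2 * Complex.I_sq
    · ring
    · ring
    · linear_combination hqC - m ^ 2 * Complex.I_sq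

/-! ### Irreducible representations -/

section Irreducible

variable {G : Type*} [Group G] {ρ : G →* SL2C}

theorem linearRep_apply (g : G) (v : Fin 2 → ℂ) : linearRep ρ g v = (ρ g).1.mulVec v := rfl

theorem not_forall_eigenvector (h : (linearRep ρ).IsIrreducible) {v : Fin 2 → ℂ} (hv : v ≠ 0) :
    ¬ ∀ g, ∃ c : ℂ, (ρ g).1.mulVec v = c • v := by
  intro hg
  let W : Subrepresentation (linearRep ρ) :=
    { toSubmodule := Submodule.span ℂ {v}
      apply_mem_toSubmodule := fun g u hu => by
        obtain ⟨d, rfl⟩ := Submodule.mem_span_singleton.1 hu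
        obtain ⟨c, hc⟩ := hg g
        rw [map_smul, linearRep_apply, hc]
        exact Submodule.smul_mem _ _ (Submodule.smul_mem _ _ (Submodule.mem_span_singleton_self v)) }
  rcases h.eq_bot_or_eq_top W with hW | hW
  · have h1 : Submodule.span ℂ {v} = ⊥ := congrArg Subrepresentation.toSubmodule hW
    exact hv (Submodule.span_singleton_eq_bot.1 h1)
  · have h1 : Submodule.span ℂ {v} = ⊤ := congrArg Subrepresentation.toSubmodule hW
    obtain ⟨c, hc⟩ := Submodule.mem_span_singleton.1
      (h1 ▸ Submodule.mem_top : (![1, 0] : Fin 2 → ℂ) ∈ Submodule.span ℂ {v})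
    obtain ⟨d, hd⟩ := Submodule.mem_span_singleton.1
      (h1 ▸ Submodule.mem_top : (![0, 1] : Fin 2 → ℂ) ∈ Submodule.span ℂ {v})
    have c0 := congrFun hc 0
    have c1 := congrFun hc 1
    have d1 := congrFun hd 1
    simp at c0 c1 d1
    rcases c1 with h | h
    · simp [h] at c0
    · simp [h] at d1

/-- Schur's lemma: an eigenspace of `ρ z` is invariant, hence everything. -/
theorem map_mem_center_of_irreducible (h : (linearRep ρ).IsIrreducible) {z : G}
    (hz : ∀ g, Commute z g) : ρ z ∈ Subgroup.center SL2C := by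
  obtain ⟨l, v, hv, hl⟩ := exists_eigenvector (ρ z).1
  let W : Subrepresentation (linearRep ρ) :=
    { toSubmodule :=
        { carrier := {u | (ρ z).1.mulVec u = l • u}
          add_mem' := fun {u w} hu hw => by
            simp only [Set.mem_ofPred_eq] at *
            rw [Matrix.mulVec_add, hu, hw, smul_add]
          zero_mem' := by simp
          smul_mem' := fun c u hu => by
            simp only [Set.mem_ofPred_eq] at *
            rw [Matrix.mulVec_smul, hu, smul_comm] }
      apply_mem_toSubmodule := fun g u hu => by
        change (ρ z).1.mulVec u = l • u at hu
        change (ρ z).1.mulVec ((ρ g).1.mulVec u) = l • (ρ g).1.mulVec u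
        rw [Matrix.mulVec_mulVec, ← Matrix.SpecialLinearGroup.coe_mul, ← map_mul, (hz g).eq,
          map_mul, Matrix.SpecialLinearGroup.coe_mul, ← Matrix.mulVec_mulVec, hu,
          Matrix.mulVec_smul] }
  have hvW : v ∈ W.toSubmodule := hl
  rcases h.eq_bot_or_eq_top W with hW | hW
  · rw [hW] at hvW
    exact absurd ((Submodule.mem_bot ℂ).1 hvW) hv
  · have hall : ∀ u, (ρ z).1.mulVec u = l • u := fun u => by
      have : u ∈ W.toSubmodule := by rw [hW]; exact Submodule.mem_top
      exact this
    have hs : (ρ z).1 = l • (1 : Matrix (Fin 2) (Fin 2) ℂ) := by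
      apply Matrix.ext_of_mulVec_single
      intro i
      rw [hall, Matrix.smul_mulVec, Matrix.one_mulVec]
    rw [Subgroup.mem_center_iff]
    intro B
    refine Subtype.ext ?_
    rw [Matrix.SpecialLinearGroup.coe_mul, Matrix.SpecialLinearGroup.coe_mul, hs]
    simp

/-- The elements of which a given vector is an eigenvector. -/
def eigenvectorSubgroup (ρ : G →* SL2C) (v : Fin 2 → ℂ) : Subgroup G where
  carrier := {g | ∃ c : ℂ, c ≠ 0 ∧ (ρ g).1.mulVec v = c • v}
  one_mem' := ⟨1, one_ne_zero, by simp⟩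
  mul_mem' := by
    rintro g k ⟨c, hc0, hc⟩ ⟨d, hd0, hd⟩
    refine ⟨d * c, mul_ne_zero hd0 hc0, ?_⟩
    rw [map_mul, Matrix.SpecialLinearGroup.coe_mul, ← Matrix.mulVec_mulVec, hd,
      Matrix.mulVec_smul, hc, smul_smul]
  inv_mem' := by
    rintro g ⟨c, hc0, hc⟩
    refine ⟨c⁻¹, inv_ne_zero hc0, ?_⟩
    have h1 := congrArg ((ρ g⁻¹).1.mulVec) hc
    rw [Matrix.mulVec_mulVec, ← Matrix.SpecialLinearGroup.coe_mul, ← map_mul, inv_mul_cancel,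
      map_one, Matrix.SpecialLinearGroup.coe_one, Matrix.one_mulVec, Matrix.mulVec_smul] at h1
    rw [eq_inv_smul_iff₀ hc0, ← h1]

theorem mem_eigenvectorSubgroup {v : Fin 2 → ℂ} (hv : v ≠ 0) {g : G} {c : ℂ}
    (h : (ρ g).1.mulVec v = c • v) : g ∈ eigenvectorSubgroup ρ v :=
  ⟨c, by rintro rfl; simpa using eigenvalue_eq (ρ g) hv h, h⟩

theorem exists_mulVec_eq_of_mem_center {A : SL2C} (hA : A ∈ Subgroup.center SL2C)
    (v : Fin 2 → ℂ) : ∃ c : ℂ, A.1.mulVec v = c • v := by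
  rcases (mem_center_sl2 A).1 hA with rfl | rfl
  · exact ⟨1, by simp⟩
  · exact ⟨-1, by simp [Matrix.neg_mulVec]⟩

theorem eigenvectorSubgroup_ne_top (h : (linearRep ρ).IsIrreducible) {v : Fin 2 → ℂ}
    (hv : v ≠ 0) : eigenvectorSubgroup ρ v ≠ ⊤ := fun ht =>
  not_forall_eigenvector h hv fun g => by
    obtain ⟨c, -, hc⟩ := (ht ▸ Subgroup.mem_top g : g ∈ eigenvectorSubgroup ρ v)
    exact ⟨c, hc⟩

end Irreducible

/-! ### Irreducible representations of Seifert groups and their traces. -/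

section SeifertRep

variable {a : Fin 3 → ℕ} {b₀ : ℤ} {b : Fin 3 → ℤ} {ρ : SeifertGroup a b₀ b →* SL2C}

theorem subgroup_eq_top_of_pair (K : Subgroup (SeifertGroup a b₀ b))
    (hf : fiber a b₀ b ∈ K) (h0 : singular a b₀ b 0 ∈ K)
    (h : singular a b₀ b 1 ∈ K ∨ singular a b₀ b 2 ∈ K) : K = ⊤ := by
  have hprod : singular a b₀ b 1 =
      (singular a b₀ b 0)⁻¹ * fiber a b₀ b ^ b₀ * (singular a b₀ b 2)⁻¹ := by
    rw [← singular_prod]; group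
  have h1 : singular a b₀ b 1 ∈ K := h.elim id fun h2 => by
    rw [hprod]
    exact K.mul_mem (K.mul_mem (K.inv_mem h0) (K.zpow_mem hf _)) (K.inv_mem h2)
  refine subgroup_eq_top_of_generators K hf fun i => ?_
  fin_cases i
  · exact h0
  · exact h1
  · change singular a b₀ b 2 ∈ K
    rw [singular_two]
    exact K.mul_mem (K.inv_mem (K.mul_mem h0 h1)) (K.zpow_mem hf _)

theorem map_fiber_mem_center (h : (linearRep ρ).IsIrreducible) :
    ρ (fiber a b₀ b) ∈ Subgroup.center SL2C := map_mem_center_of_irreducible h fiber_commute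

theorem fiber_mem_eigenvectorSubgroup (h : (linearRep ρ).IsIrreducible) {v : Fin 2 → ℂ}
    (hv : v ≠ 0) : fiber a b₀ b ∈ eigenvectorSubgroup ρ v := by
  obtain ⟨c, hc⟩ := exists_mulVec_eq_of_mem_center (map_fiber_mem_center h) v
  exact mem_eigenvectorSubgroup hv hc

theorem not_hasCommonEigenvector_of_irreducible (h : (linearRep ρ).IsIrreducible) :
    ¬ HasCommonEigenvector (ρ (singular a b₀ b 0)) (ρ (singular a b₀ b 1)) := by
  rintro ⟨v, hv, ⟨l, hl⟩, m, hm⟩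
  exact eigenvectorSubgroup_ne_top h hv (subgroup_eq_top_of_pair _
    (fiber_mem_eigenvectorSubgroup h hv) (mem_eigenvectorSubgroup hv hl)
    (Or.inl (mem_eigenvectorSubgroup hv hm)))

/-- Otherwise any eigenvector of another singular generator would be shared with this one, and two
singular generators together with the fiber generate the group. -/
theorem map_singular_not_mem_center (h : (linearRep ρ).IsIrreducible) (i : Fin 3) :
    ρ (singular a b₀ b i) ∉ Subgroup.center SL2C := by
  intro hc
  have key : ∀ j, ∃ v : Fin 2 → ℂ, v ≠ 0 ∧ singular a b₀ b i ∈ eigenvectorSubgroup ρ v ∧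
      singular a b₀ b j ∈ eigenvectorSubgroup ρ v := fun j => by
    obtain ⟨l, v, hv, hl⟩ := exists_eigenvector (ρ (singular a b₀ b j)).1
    obtain ⟨c, hc'⟩ := exists_mulVec_eq_of_mem_center hc v
    exact ⟨v, hv, mem_eigenvectorSubgroup hv hc', mem_eigenvectorSubgroup hv hl⟩
  fin_cases i
  · obtain ⟨v, hv, h0, h1⟩ := key 1
    exact eigenvectorSubgroup_ne_top h hv (subgroup_eq_top_of_pair _
      (fiber_mem_eigenvectorSubgroup h hv) h0 (Or.inl h1))
  · obtain ⟨v, hv, h1, h0⟩ := key 0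
    exact eigenvectorSubgroup_ne_top h hv (subgroup_eq_top_of_pair _
      (fiber_mem_eigenvectorSubgroup h hv) h0 (Or.inl h1))
  · obtain ⟨v, hv, h2, h0⟩ := key 0
    exact eigenvectorSubgroup_ne_top h hv (subgroup_eq_top_of_pair _
      (fiber_mem_eigenvectorSubgroup h hv) h0 (Or.inr h2))

theorem sq_eq_one_of_mem_center {A : SL2C} (hA : A ∈ Subgroup.center SL2C) : A ^ 2 = 1 := by
  rcases (mem_center_sl2 A).1 hA with rfl | rfl <;> simp

theorem exists_trace_eq_cos {A : SL2C} {n : ℕ} (hn : 0 < n) (hA : A ^ (2 * n) = 1)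
    (hc : A ∉ Subgroup.center SL2C) :
    ∃ m : ℤ, 0 < m ∧ m < n ∧ A.1.trace = ((2 * Real.cos (Real.pi * (m / n)) : ℝ) : ℂ) := by
  have hn0 : (n : ℝ) ≠ 0 := by exact_mod_cast hn.ne'
  have hn0' : (n : ℂ) ≠ 0 := by exact_mod_cast hn.ne'
  obtain ⟨l, hl, hl'⟩ := exists_trace_of_pow_eq_one A hA
  have : NeZero (2 * n) := ⟨by omega⟩
  obtain ⟨j, hj, rfl⟩ := (Complex.isPrimitiveRoot_exp (2 * n) (by omega)).eq_pow_of_pow_eq_one hl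
  have hexp : Complex.exp (2 * Real.pi * Complex.I / (2 * n : ℕ)) ^ j =
      Complex.exp ((Real.pi * (j / n) : ℝ) * Complex.I) := by
    rw [← Complex.exp_nat_mul]
    congr 1; push_cast; field_simp
  rw [hexp] at hl'
  have htr : A.1.trace = ((2 * Real.cos (Real.pi * (j / n)) : ℝ) : ℂ) := by
    have h1 := Complex.two_cos (Real.pi * (j / n) : ℝ)
    rw [Complex.ofReal_mul, Complex.ofReal_cos, Complex.ofReal_ofNat, h1]
    have h2 : Complex.exp ((Real.pi * (j / n) : ℝ) * Complex.I) *
        Complex.exp (-(Real.pi * (j / n) : ℝ) * Complex.I) = 1 := by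
      rw [← Complex.exp_add, neg_mul, add_neg_cancel, Complex.exp_zero]
    apply mul_left_cancel₀ (Complex.exp_ne_zero ((Real.pi * (j / n) : ℝ) * Complex.I))
    linear_combination hl' - h2
  -- Trace `±2` would make `A`, having finite order, scalar and so central. This excludes `j = 0`
  -- and `j = n`; the remaining `j > n` are replaced by `2n - j`, with the same cosine.
  have hscalar : ∀ ε : ℝ, ε ^ 2 = 1 → Real.cos (Real.pi * (j / n)) ≠ ε := by
    rintro ε hε h
    have h1 := eq_scalar_of_pow_eq_one A (by omega) hA (ε := (ε : ℂ)) (by exact_mod_cast hε)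
      (by rw [htr, h]; push_cast; ring)
    apply hc
    rw [Subgroup.mem_center_iff]
    intro B
    refine Subtype.ext ?_
    rw [Matrix.SpecialLinearGroup.coe_mul, Matrix.SpecialLinearGroup.coe_mul, h1]
    simp
  have hj0 : j ≠ 0 := by
    rintro rfl
    exact hscalar 1 (by norm_num) (by simp)
  have hjn : j ≠ n := by
    rintro rfl
    exact hscalar (-1) (by norm_num) (by rw [div_self hn0]; simp)
  rcases lt_or_gt_of_ne hjn with h | h
  · exact ⟨j, by omega, by omega, by simpa using htr⟩
  · refine ⟨2 * n - j, by omega, by omega, ?_⟩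
    rw [htr, ← Real.cos_two_pi_sub]
    congr 3
    push_cast; field_simp

theorem trace_eq_of_mul_mem_center {A B : SL2C} (h : A * B = 1 ∨ A * B = -1) :
    (A * B = 1 ∧ A.1.trace = B.1.trace) ∨ (A * B = -1 ∧ A.1.trace = -B.1.trace) := by
  have hinv : (B⁻¹).1.trace = B.1.trace := by
    rw [Matrix.SpecialLinearGroup.coe_inv, adjugate_eq_trace_sub, Matrix.trace_sub,
      Matrix.trace_smul, Matrix.trace_one]
    simp; ring
  rcases h with h | h
  · exact Or.inl ⟨h, by rw [eq_inv_of_mul_eq_one_left h, hinv]⟩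
  · refine Or.inr ⟨h, ?_⟩
    rw [eq_mul_inv_of_mul_eq h, neg_one_mul, Matrix.SpecialLinearGroup.coe_neg, Matrix.trace_neg,
      hinv]

/-- Irreducible representations which agree on the fiber and have the same characters are
conjugate. -/
theorem repConj_of_trace_eq {ρ ρ' : SeifertGroup a b₀ b →* SL2C}
    (hc : ρ (fiber a b₀ b) ∈ Subgroup.center SL2C) (hf : ρ' (fiber a b₀ b) = ρ (fiber a b₀ b))
    (hx : (ρ' (singular a b₀ b 0)).1.trace = (ρ (singular a b₀ b 0)).1.trace)
    (hy : (ρ' (singular a b₀ b 1)).1.trace = (ρ (singular a b₀ b 1)).1.trace)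
    (ht : (ρ' (singular a b₀ b 0) * ρ' (singular a b₀ b 1)).1.trace =
      (ρ (singular a b₀ b 0) * ρ (singular a b₀ b 1)).1.trace)
    (hk : fricke (ρ (singular a b₀ b 0)).1.trace (ρ (singular a b₀ b 1)).1.trace
      (ρ (singular a b₀ b 0) * ρ (singular a b₀ b 1)).1.trace ≠ 0) : RepConj ρ ρ' := by
  obtain ⟨P, h0, h1⟩ := exists_conj_of_trace_eq
    (not_hasCommonEigenvector_of_fricke_ne_zero hk)
    (not_hasCommonEigenvector_of_fricke_ne_zero (X := ρ' (singular a b₀ b 0))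
      (Y := ρ' (singular a b₀ b 1)) (by rwa [hx, hy, ht])) hx hy ht
  have : ρ' = (MulAut.conj P).toMonoidHom.comp ρ := by
    refine seifertGroup_hom_ext_of_pair ?_ h0 h1
    change _ = P * ρ (fiber a b₀ b) * P⁻¹
    rw [hf, Subgroup.mem_center_iff.1 hc P, mul_inv_cancel_right]
  exact ⟨P, DFunLike.congr_fun this⟩

end SeifertRep

/-! ### Trigonometry -/

/-- This factorization turns the sign of `fricke` into linear inequalities between angles. The minus
sign at `C` reflects that rotations of a triangle have product lifting to `sh (-1)`, which projects
to `-1`. -/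
theorem fricke_cos (A B C : ℝ) : fricke (2 * Real.cos A) (2 * Real.cos B) (-(2 * Real.cos C)) =
    4 * ((Real.cos (A + B) + Real.cos C) * (Real.cos (A - B) + Real.cos C)) := by
  have h1 := Real.sin_sq_add_cos_sq A
  have h2 := Real.sin_sq_add_cos_sq B
  rw [Real.cos_add, Real.cos_sub, fricke]
  linear_combination (4 * Real.sin B ^ 2) * h1 + (4 - 4 * Real.cos A ^ 2) * h2

theorem fricke_sign_mul {K : Type*} [CommRing K] {e f : K} (he : e ^ 2 = 1) (hf : f ^ 2 = 1)
    (x y t : K) : fricke (e * x) (f * y) (e * f * t) = fricke x y t := by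
  simp only [fricke]
  linear_combination (x ^ 2 + t ^ 2 * f ^ 2 - f ^ 2 * x * y * t) * he +
    (y ^ 2 + t ^ 2 - x * y * t) * hf

theorem cos_add_cos_pos_iff {A C : ℝ} (hA0 : 0 ≤ A) (hA : A ≤ Real.pi) (hC0 : 0 ≤ C)
    (hC : C ≤ Real.pi) : 0 < Real.cos A + Real.cos C ↔ A + C < Real.pi := by
  rw [← neg_lt_iff_pos_add, ← Real.cos_pi_sub,
    Real.strictAntiOn_cos.lt_iff_gt ⟨by linarith, by linarith⟩ ⟨hA0, hA⟩, lt_sub_iff_add_lt]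

theorem fricke_cos_pos {A B C : ℝ} (hA : 0 < A) (hB : 0 < B) (hC : 0 < C)
    (h : A + B + C < Real.pi) :
    0 < fricke (2 * Real.cos A) (2 * Real.cos B) (-(2 * Real.cos C)) := by
  rw [fricke_cos]
  have h1 := (cos_add_cos_pos_iff (A := A + B) (C := C) (by linarith) (by linarith) hC.le
    (by linarith)).2 h
  have h2 := (cos_add_cos_pos_iff (A := |A - B|) (C := C) (abs_nonneg _)
    (abs_le.2 ⟨by linarith, by linarith⟩) hC.le (by linarith)).2 (by
      rcases abs_cases (A - B) with h | h <;> linarith)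
  rw [Real.cos_abs] at h2
  positivity

/-- If the Fricke polynomial is positive then the angles become those of a hyperbolic triangle when
an even number of them are replaced by their supplements. -/
theorem triangle_cases_of_fricke_pos {A B C : ℝ} (hA : 0 < A) (hA' : A < Real.pi) (hB : 0 < B)
    (hB' : B < Real.pi) (hC : 0 < C) (hC' : C < Real.pi)
    (h : 0 < fricke (2 * Real.cos A) (2 * Real.cos B) (-(2 * Real.cos C))) :
    A + B + C < Real.pi ∨ Real.pi < A + B - C ∨ Real.pi < A + C - B ∨ Real.pi < B + C - A := by
  rw [fricke_cos, mul_pos_iff_of_pos_left (by norm_num), mul_pos_iff] at h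
  have hd : |A - B| ≤ Real.pi := abs_le.2 ⟨by linarith, by linarith⟩
  have hdiff := (cos_add_cos_pos_iff (A := |A - B|) (C := C) (abs_nonneg _) hd hC.le hC'.le)
  rw [Real.cos_abs] at hdiff
  -- Both factors positive gives the first or second alternative, according to whether `A + B`
  -- exceeds `π`. Both negative forces `|A - B| + C > π`, which is one of the last two.
  rcases h with ⟨h1, h2⟩ | ⟨h1, h2⟩
  · rcases le_or_gt (A + B) Real.pi with hs | hs
    · exact Or.inl ((cos_add_cos_pos_iff (by linarith) hs hC.le hC'.le).1 h1)
    · right; left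
      rw [← Real.cos_two_pi_sub] at h1
      have := (cos_add_cos_pos_iff (by linarith) (by linarith) hC.le hC'.le).1 h1
      linarith
  · right; right
    by_contra! hcon
    have h3 : Real.pi ≤ |A - B| + C := by
      by_contra! h4
      linarith [hdiff.2 h4]
    have h4 : |A - B| + C = Real.pi := by
      rcases abs_cases (A - B) with h | h <;> linarith
    have h5 : Real.cos (A - B) + Real.cos C = 0 := by
      rw [← Real.cos_abs, eq_sub_of_add_eq h4, Real.cos_pi_sub]; ring
    linarith

theorem eq_or_eq_one_sub_of_cos {r s e : ℝ} (hr0 : 0 < r) (hr1 : r < 1) (hs0 : 0 < s)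
    (hs1 : s < 1) (he : e = 1 ∨ e = -1)
    (h : Real.cos (Real.pi * s) = e * Real.cos (Real.pi * r)) :
    (e = 1 ∧ s = r) ∨ (e = -1 ∧ s = 1 - r) := by
  have hπ := Real.pi_pos
  have hmem : ∀ t : ℝ, 0 < t → t < 1 → Real.pi * t ∈ Set.Icc 0 Real.pi := fun t h0 h1 =>
    ⟨by positivity, by nlinarith⟩
  rcases he with rfl | rfl
  · left
    rw [one_mul] at h
    exact ⟨rfl, mul_left_cancel₀ hπ.ne' (Real.injOn_cos (hmem s hs0 hs1) (hmem r hr0 hr1) h)⟩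
  · right
    rw [neg_one_mul, ← Real.cos_pi_sub, show Real.pi - Real.pi * r = Real.pi * (1 - r) by ring]
      at h
    exact ⟨rfl, mul_left_cancel₀ hπ.ne' (Real.injOn_cos (hmem s hs0 hs1)
      (hmem (1 - r) (by linarith) (by linarith)) h)⟩

/-- The angles of a hyperbolic triangle are determined by the traces up to an even number of
signs. -/
theorem triangle_angles_unique {r s e : Fin 3 → ℝ} (hr : ∀ i, 0 < r i) (hs : ∀ i, 0 < s i)
    (hr1 : r 0 + r 1 + r 2 < 1) (hs1 : s 0 + s 1 + s 2 < 1) (he : ∀ i, e i = 1 ∨ e i = -1)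
    (hprod : e 0 * e 1 * e 2 = 1)
    (h : ∀ i, Real.cos (Real.pi * s i) = e i * Real.cos (Real.pi * r i)) : s = r := by
  have r0 := hr 0
  have r1 := hr 1
  have r2 := hr 2
  have s0 := hs 0
  have s1 := hs 1
  have s2 := hs 2
  have h0 := eq_or_eq_one_sub_of_cos r0 (by linarith) s0 (by linarith) (he 0) (h 0)
  have h1 := eq_or_eq_one_sub_of_cos r1 (by linarith) s1 (by linarith) (he 1) (h 1)
  have h2 := eq_or_eq_one_sub_of_cos r2 (by linarith) s2 (by linarith) (he 2) (h 2)
  -- An odd number of flips contradicts `hprod`. Two flips give `sᵢ + sⱼ = 2 - (rᵢ + rⱼ) > 1`,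
  -- contradicting the angle sum.
  rcases h0 with ⟨h0, h0'⟩ | ⟨h0, h0'⟩ <;> rcases h1 with ⟨h1, h1'⟩ | ⟨h1, h1'⟩ <;>
    rcases h2 with ⟨h2, h2'⟩ | ⟨h2, h2'⟩ <;> rw [h0, h1, h2] at hprod <;>
    first
    | (exfalso; norm_num at hprod; done)
    | (exfalso; linarith)
    | (ext i; fin_cases i <;> assumption)

/-! ### Lifts determined by an Euler class -/

section Lift

variable {a : Fin 3 → ℕ} {b₀ : ℤ} {b : Fin 3 → ℤ}

/-- Modulo `aᵢ` the degree is `βᵢ` times the product of the other two `aⱼ`, and by `hb` that product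
is inverse to `bᵢ`; hence `βᵢ - k bᵢ` is divisible by `aᵢ`. The second equation follows after
multiplying by `a₁a₂a₃`. -/
theorem exists_lift_coefficients (ha : ∀ i, 0 < a i)
    (hb : (a 0 : ℤ) * a 1 * a 2 * b₀ + b 0 * (a 1 * a 2) + b 1 * (a 0 * a 2) + b 2 * (a 0 * a 1)
      = 1) (β₀ : ℤ) (β : Fin 3 → ℤ) :
    ∃ c : Fin 3 → ℤ, (∀ i, β i = a i * c i + eulerDegree a (eulerClass a β₀ β) * b i) ∧
      β₀ + c 0 + c 1 + c 2 = eulerDegree a (eulerClass a β₀ β) * b₀ := by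
  rw [eulerDegree_eulerClass]
  set k : ℤ := (a 0 : ℤ) * a 1 * a 2 * β₀ + β 0 * (a 1 * a 2) + β 1 * (a 0 * a 2) +
    β 2 * (a 0 * a 1) with hk
  have hdvd : ∀ i, ∃ c : ℤ, β i = a i * c + k * b i := by
    intro i
    fin_cases i
    · refine ⟨β 0 * (a 1 * a 2 * b₀ + b 1 * a 2 + b 2 * a 1) -
        (a 1 * a 2 * β₀ + β 1 * a 2 + β 2 * a 1) * b 0, ?_⟩
      change β 0 = a 0 * _ + k * b 0
      rw [hk]
      linear_combination (-β 0) * hb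
    · refine ⟨β 1 * (a 0 * a 2 * b₀ + b 0 * a 2 + b 2 * a 0) -
        (a 0 * a 2 * β₀ + β 0 * a 2 + β 2 * a 0) * b 1, ?_⟩
      change β 1 = a 1 * _ + k * b 1
      rw [hk]
      linear_combination (-β 1) * hb
    · refine ⟨β 2 * (a 0 * a 1 * b₀ + b 0 * a 1 + b 1 * a 0) -
        (a 0 * a 1 * β₀ + β 0 * a 1 + β 1 * a 0) * b 2, ?_⟩
      change β 2 = a 2 * _ + k * b 2
      rw [hk]
      linear_combination (-β 2) * hb
  choose c hc using hdvd
  refine ⟨c, hc, ?_⟩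
  have h0 : ((a 0 : ℤ) * a 1 * a 2) ≠ 0 := by
    have := ha 0
    have := ha 1
    have := ha 2
    positivity
  apply mul_left_cancel₀ h0
  linear_combination (-(a 1 * a 2 : ℤ)) * hc 0 - (a 0 * a 2 : ℤ) * hc 1 - (a 0 * a 1 : ℤ) * hc 2
    - k * hb - hk

theorem cos_int_sub (c : ℤ) (r : ℝ) :
    Real.cos (Real.pi * (c - r)) = (-1) ^ c * Real.cos (Real.pi * r) := by
  rw [mul_sub, mul_comm Real.pi (c : ℝ), Real.cos_int_mul_pi_sub]

theorem neg_one_zpow_cases {K : Type*} [DivisionRing K] (c : ℤ) :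
    (-1 : K) ^ c = 1 ∨ (-1 : K) ^ c = -1 := by
  rcases Int.even_or_odd c with h | h
  · exact Or.inl h.neg_one_zpow
  · exact Or.inr h.neg_one_zpow

theorem trace_rotation_int_mul (n : ℤ) (A : SL2R) :
    (rotation n * A).1.trace = (-1) ^ n * A.1.trace := by
  rw [rotation_int]
  rcases Int.even_or_odd n with h | h
  · rw [h.neg_one_zpow, h.neg_one_zpow, one_mul, one_mul]
  · rw [h.neg_one_zpow, h.neg_one_zpow, neg_one_mul, Matrix.SpecialLinearGroup.coe_neg,
      Matrix.trace_neg, neg_one_mul]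

variable {θ : SeifertGroup a b₀ b →* UnivPSL} {k : ℤ} {β c : Fin 3 → ℤ}

/-- The image is conjugate to the translation by `-bᵢk / aᵢ = cᵢ - βᵢ / aᵢ`, so its trace depends on
`β` and `c` only. -/
theorem trace_lift_singular (ha : ∀ i, 0 < a i) (hθ : θ (fiber a b₀ b) = sh k)
    (hβ : ∀ i, β i = a i * c i + k * b i) (i : Fin 3) :
    (UnivPSL.toSL (θ (singular a b₀ b i))).1.trace =
      (-1) ^ c i * (2 * Real.cos (Real.pi * (β i / a i))) := by
  have hai : (a i : ℝ) ≠ 0 := by exact_mod_cast (ha i).ne'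
  have h : θ (singular a b₀ b i) ^ a i = sh ((-b i * k : ℤ) : ℝ) := by
    rw [← map_pow, singular_pow, map_zpow, hθ, sh_zpow]; push_cast; rfl
  rw [trace_toSL_of_pow (ha i) h, mul_left_comm, ← cos_int_sub, hβ i]
  congr 3
  push_cast; field_simp; ring

/-- Write `xy = h ^ b₀ z⁻¹`. The fiber contributes the sign `(-1) ^ (k b₀)`, whose `c 2` part
cancels against `z`; the leading minus comes from `β₀ = -1`. -/
theorem trace_lift_mul (ha : ∀ i, 0 < a i) (hθ : θ (fiber a b₀ b) = sh k)
    (hβ : ∀ i, β i = a i * c i + k * b i) (hsum : -1 + c 0 + c 1 + c 2 = k * b₀) :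
    (UnivPSL.toSL (θ (singular a b₀ b 0)) * UnivPSL.toSL (θ (singular a b₀ b 1))).1.trace =
      (-1) ^ c 0 * (-1) ^ c 1 * (-(2 * Real.cos (Real.pi * (β 2 / a 2)))) := by
  have h : θ (singular a b₀ b 0) * θ (singular a b₀ b 1) =
      sh ((k * b₀ : ℤ) : ℝ) * (θ (singular a b₀ b 2))⁻¹ := by
    rw [eq_mul_inv_iff_mul_eq, ← map_mul, ← map_mul, singular_prod, map_zpow, hθ, sh_zpow]
    congr 1; push_cast; ring
  have hne : (-1 : ℝ) ≠ 0 := by norm_num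
  rw [← map_mul, h, map_mul, toSL_sh, trace_rotation_int_mul, map_inv, trace_inv,
    trace_lift_singular ha hθ hβ, ← hsum, zpow_add₀ hne, zpow_add₀ hne, zpow_add₀ hne]
  have h2 : ((-1 : ℝ) ^ c 2) * (-1) ^ c 2 = 1 := by
    rcases neg_one_zpow_cases (K := ℝ) (c 2) with h | h <;> rw [h] <;> norm_num
  rw [zpow_neg_one]
  linear_combination (-1 : ℝ) * (-1) ^ c 0 * (-1) ^ c 1 *
    (2 * Real.cos (Real.pi * (β 2 / a 2))) * h2

theorem complexify_fiber (hθ : θ (fiber a b₀ b) = sh k) :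
    complexify (UnivPSL.toSL.comp θ) (fiber a b₀ b) = (-1) ^ k := by
  have h1 : Matrix.SpecialLinearGroup.map (n := Fin 2) (algebraMap ℝ ℂ) (-1) = -1 := by
    ext i j; fin_cases i <;> fin_cases j <;> simp
  change Matrix.SpecialLinearGroup.map (algebraMap ℝ ℂ) (UnivPSL.toSL (θ (fiber a b₀ b))) = _
  rw [hθ, toSL_sh, rotation_int, map_zpow, h1]

theorem neg_one_zpow_mem_center (k : ℤ) : (-1 : SL2C) ^ k ∈ Subgroup.center SL2C :=
  zpow_mem ((mem_center_sl2 _).2 (Or.inr rfl)) k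

theorem trace_complexify (σ : SeifertGroup a b₀ b →* SL2R) (g : SeifertGroup a b₀ b) :
    (complexify σ g).1.trace = ((σ g).1.trace : ℂ) := map_ofReal_trace _

theorem trace_complexify_mul (σ : SeifertGroup a b₀ b →* SL2R) (g g' : SeifertGroup a b₀ b) :
    (complexify σ g * complexify σ g').1.trace = ((σ g * σ g').1.trace : ℂ) := by
  rw [← map_mul, trace_complexify, map_mul]

theorem ofReal_fricke (x y t : ℝ) :
    ((fricke x y t : ℝ) : ℂ) = fricke (x : ℂ) (y : ℂ) (t : ℂ) := by
  simp only [fricke]; push_cast; ring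

end Lift

/-! ### Classes of hyperbolic triangles -/

section Classes

variable {a : Fin 3 → ℕ} {b₀ : ℤ} {b : Fin 3 → ℤ} {β : Fin 3 → ℤ}

theorem sum_div_lt_one_iff : ∑ i, (β i : ℚ) / (a i : ℚ) < 1 ↔
    (β 0 : ℝ) / a 0 + β 1 / a 1 + β 2 / a 2 < 1 := by
  rw [Fin.sum_univ_three]
  exact_mod_cast (Rat.cast_lt (K := ℝ)
    (p := (β 0 : ℚ) / a 0 + β 1 / a 1 + β 2 / a 2) (q := 1)).symm

theorem eulerDegree_neg (ha : ∀ i, 0 < a i)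
    (hsum : (β 0 : ℝ) / a 0 + β 1 / a 1 + β 2 / a 2 < 1) :
    eulerDegree a (eulerClass a (-1) β) < 0 := by
  have h0 : (0 : ℝ) < a 0 := by exact_mod_cast ha 0
  have h1 : (0 : ℝ) < a 1 := by exact_mod_cast ha 1
  have h2 : (0 : ℝ) < a 2 := by exact_mod_cast ha 2
  have h : ((eulerDegree a (eulerClass a (-1) β) : ℤ) : ℝ) =
      a 0 * a 1 * a 2 * ((β 0 : ℝ) / a 0 + β 1 / a 1 + β 2 / a 2 - 1) := by
    rw [eulerDegree_eulerClass]; push_cast; field_simp; ring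
  have h3 : ((eulerDegree a (eulerClass a (-1) β) : ℤ) : ℝ) < 0 := by
    rw [h]
    exact mul_neg_of_pos_of_neg (by positivity) (by linarith)
  exact_mod_cast h3

/-- Twist the generators of `exists_triangle` by `sh (cᵢ)`. Their product `sh (-1)` matches `β₀ =
-1`, and the degree is nonzero because the angle sum is less than `π`. -/
theorem exists_isInducedRep (ha : ∀ i, 0 < a i)
    (hb : (a 0 : ℤ) * a 1 * a 2 * b₀ + b 0 * (a 1 * a 2) + b 1 * (a 0 * a 2) + b 2 * (a 0 * a 1)
      = 1) (hβ : ∀ i, 0 < β i) (hsum : (β 0 : ℝ) / a 0 + β 1 / a 1 + β 2 / a 2 < 1) :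
    ∃ σ : SeifertGroup a b₀ b →* SL2R, IsInducedRep (eulerClass a (-1) β) σ := by
  obtain ⟨c, hc, hc0⟩ := exists_lift_coefficients ha hb (-1) β
  have hk := (eulerDegree_neg ha hsum).ne
  set k := eulerDegree a (eulerClass a (-1) β)
  obtain ⟨X, hX, hprod⟩ := exists_triangle (r := fun i => (β i : ℝ) / a i) (fun i =>
    div_pos (by exact_mod_cast hβ i) (by exact_mod_cast ha i)) hsum
  obtain ⟨θ, hθ, -⟩ := exists_seifertGroup_hom (a := a) (b₀ := b₀) (b := b)
    (fun i => X i * sh (c i)) (sh k) (fun i => sh_int_commute k _)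
    (fun i => by
      obtain ⟨P, hP⟩ := hX i
      have hai : (a i : ℝ) ≠ 0 := by exact_mod_cast (ha i).ne'
      have h1 : (a i : ℝ) * -((β i : ℝ) / a i) = ((-β i : ℤ) : ℝ) := by
        push_cast; field_simp
      rw [sh_int_mul_pow, hP, conj_pow, sh_pow, h1, ← (sh_int_commute (-β i) P).eq,
        mul_inv_cancel_right, ← sh_add, sh_zpow, hc i]
      congr 1; push_cast; ring)
    (by
      rw [mul_sh_int_mul, hprod, ← sh_add, sh_zpow]
      congr 1
      have : (b₀ : ℝ) * k = ((k * b₀ : ℤ) : ℝ) := by push_cast; ring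
      rw [this, ← hc0]; push_cast; ring)
  exact ⟨_, isInducedRep_of_lift hb hk hθ hc hc0⟩

/-- The traces and the image of the fiber depend on the class only, and the Fricke polynomial is
positive for the angles of a hyperbolic triangle. -/
theorem IsInducedRep.repConj (ha : ∀ i, 0 < a i)
    (hb : (a 0 : ℤ) * a 1 * a 2 * b₀ + b 0 * (a 1 * a 2) + b 1 * (a 0 * a 2) + b 2 * (a 0 * a 1)
      = 1) (hβ : ∀ i, 0 < β i) (hsum : (β 0 : ℝ) / a 0 + β 1 / a 1 + β 2 / a 2 < 1)
    {σ σ' : SeifertGroup a b₀ b →* SL2R} (hσ : IsInducedRep (eulerClass a (-1) β) σ)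
    (hσ' : IsInducedRep (eulerClass a (-1) β) σ') : RepConj (complexify σ) (complexify σ') := by
  obtain ⟨θ, hθ, rfl⟩ := hσ.exists_lift hb
  obtain ⟨θ', hθ', rfl⟩ := hσ'.exists_lift hb
  obtain ⟨c, hc, hc0⟩ := exists_lift_coefficients ha hb (-1) β
  set k := eulerDegree a (eulerClass a (-1) β)
  have hpos : ∀ i, 0 < Real.pi * ((β i : ℝ) / a i) := fun i =>
    mul_pos Real.pi_pos (div_pos (by exact_mod_cast hβ i) (by exact_mod_cast ha i))
  have hsq : ∀ n : ℤ, ((-1 : ℝ) ^ n) ^ 2 = 1 := fun n => by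
    rcases neg_one_zpow_cases (K := ℝ) n with h | h <;> rw [h] <;> norm_num
  have hf := fricke_cos_pos (hpos 0) (hpos 1) (hpos 2) (by
    rw [← mul_add, ← mul_add]; nlinarith [Real.pi_pos])
  rw [← fricke_sign_mul (hsq (c 0)) (hsq (c 1))] at hf
  refine repConj_of_trace_eq ?_ ?_ ?_ ?_ ?_ ?_
  · rw [complexify_fiber hθ]
    exact neg_one_zpow_mem_center k
  · rw [complexify_fiber hθ, complexify_fiber hθ']
  · rw [trace_complexify, trace_complexify, MonoidHom.comp_apply, MonoidHom.comp_apply,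
      trace_lift_singular ha hθ hc, trace_lift_singular ha hθ' hc]
  · rw [trace_complexify, trace_complexify, MonoidHom.comp_apply, MonoidHom.comp_apply,
      trace_lift_singular ha hθ hc, trace_lift_singular ha hθ' hc]
  · simp only [trace_complexify_mul, MonoidHom.comp_apply]
    rw [trace_lift_mul ha hθ hc hc0, trace_lift_mul ha hθ' hc hc0]
  · rw [trace_complexify, trace_complexify, trace_complexify_mul]
    simp only [MonoidHom.comp_apply]
    rw [trace_lift_mul ha hθ hc hc0, trace_lift_singular ha hθ hc, trace_lift_singular ha hθ hc,
      ← ofReal_fricke]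
    exact_mod_cast hf.ne'

theorem exists_center_trace_mul {e : ℝ} (he : e = 1 ∨ e = -1) :
    ∃ z ∈ Subgroup.center SL2C, ∀ A : SL2C, (z * A).1.trace = e * A.1.trace := by
  rcases he with rfl | rfl
  · exact ⟨1, one_mem _, fun A => by simp⟩
  · refine ⟨-1, (mem_center_sl2 _).2 (Or.inr rfl), fun A => ?_⟩
    rw [neg_one_mul, Matrix.SpecialLinearGroup.coe_neg, Matrix.trace_neg]; simp

/-- A representation whose traces are, up to signs, those of a hyperbolic triangle is induced. -/
theorem exists_isInducedRep_of_trace_eq (ha : ∀ i, 0 < a i)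
    (hb : (a 0 : ℤ) * a 1 * a 2 * b₀ + b 0 * (a 1 * a 2) + b 1 * (a 0 * a 2) + b 2 * (a 0 * a 1)
      = 1) (hβ : ∀ i, 0 < β i) (hsum : (β 0 : ℝ) / a 0 + β 1 / a 1 + β 2 / a 2 < 1)
    {ρ : SeifertGroup a b₀ b →* SL2C} (hρ : (linearRep ρ).IsIrreducible) {e f : ℝ}
    (he : e = 1 ∨ e = -1) (hf : f = 1 ∨ f = -1)
    (hx : (ρ (singular a b₀ b 0)).1.trace =
      ((e * (2 * Real.cos (Real.pi * (β 0 / a 0))) : ℝ) : ℂ))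
    (hy : (ρ (singular a b₀ b 1)).1.trace =
      ((f * (2 * Real.cos (Real.pi * (β 1 / a 1))) : ℝ) : ℂ))
    (ht : (ρ (singular a b₀ b 0) * ρ (singular a b₀ b 1)).1.trace =
      ((e * f * (-(2 * Real.cos (Real.pi * (β 2 / a 2)))) : ℝ) : ℂ)) :
    ∃ σ : SeifertGroup a b₀ b →* SL2R, IsInducedRep (eulerClass a (-1) β) σ ∧
      RepConj ρ (complexify σ) := by
  obtain ⟨σ, hσ⟩ := exists_isInducedRep ha hb hβ hsum
  refine ⟨σ, hσ, ?_⟩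
  obtain ⟨θ, hθ, rfl⟩ := hσ.exists_lift hb
  obtain ⟨c, hc, hc0⟩ := exists_lift_coefficients ha hb (-1) β
  set k := eulerDegree a (eulerClass a (-1) β)
  have hpos : ∀ i, 0 < Real.pi * ((β i : ℝ) / a i) := fun i =>
    mul_pos Real.pi_pos (div_pos (by exact_mod_cast hβ i) (by exact_mod_cast ha i))
  have hfr := fricke_cos_pos (hpos 0) (hpos 1) (hpos 2) (by
    rw [← mul_add, ← mul_add]; nlinarith [Real.pi_pos])
  have hsq : ∀ {e : ℝ}, e = 1 ∨ e = -1 → e ^ 2 = 1 := by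
    rintro e (h | h) <;> rw [h] <;> norm_num
  rw [← fricke_sign_mul (hsq he) (hsq hf)] at hfr
  have hsgn : ∀ {e : ℝ} (n : ℤ), e = 1 ∨ e = -1 → e * (-1) ^ n = 1 ∨ e * (-1) ^ n = -1 := by
    rintro e n (h | h) <;> rcases neg_one_zpow_cases (K := ℝ) n with h' | h' <;> rw [h, h'] <;>
      norm_num
  have hcc : ∀ n : ℤ, (-1 : ℝ) ^ n * (-1) ^ n = 1 := fun n => by
    rw [← sq]; exact hsq (neg_one_zpow_cases n)
  -- The central signs `z` and `w` make the traces of the induced pair equal to those of `ρ`. They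
  -- do no harm, since homomorphisms from a perfect group agreeing up to the center are equal.
  obtain ⟨z, hz, hzt⟩ := exists_center_trace_mul (hsgn (c 0) he)
  obtain ⟨w, hw, hwt⟩ := exists_center_trace_mul (hsgn (c 1) hf)
  set σ' := complexify (UnivPSL.toSL.comp θ) with hσ'
  have t0 : (σ' (singular a b₀ b 0)).1.trace =
      (((-1) ^ c 0 * (2 * Real.cos (Real.pi * (β 0 / a 0))) : ℝ) : ℂ) := by
    rw [hσ', trace_complexify, MonoidHom.comp_apply, trace_lift_singular ha hθ hc]
  have t1 : (σ' (singular a b₀ b 1)).1.trace =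
      (((-1) ^ c 1 * (2 * Real.cos (Real.pi * (β 1 / a 1))) : ℝ) : ℂ) := by
    rw [hσ', trace_complexify, MonoidHom.comp_apply, trace_lift_singular ha hθ hc]
  have t2 : (σ' (singular a b₀ b 0) * σ' (singular a b₀ b 1)).1.trace =
      (((-1) ^ c 0 * (-1) ^ c 1 * (-(2 * Real.cos (Real.pi * (β 2 / a 2)))) : ℝ) : ℂ) := by
    rw [hσ', trace_complexify_mul]
    simp only [MonoidHom.comp_apply]
    rw [trace_lift_mul ha hθ hc hc0]
  have e0 : (z * σ' (singular a b₀ b 0)).1.trace = (ρ (singular a b₀ b 0)).1.trace := by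
    rw [hzt, t0, hx, ← Complex.ofReal_mul]
    congr 1
    linear_combination (e * (2 * Real.cos (Real.pi * (β 0 / a 0)))) * hcc (c 0)
  have e1 : (w * σ' (singular a b₀ b 1)).1.trace = (ρ (singular a b₀ b 1)).1.trace := by
    rw [hwt, t1, hy, ← Complex.ofReal_mul]
    congr 1
    linear_combination (f * (2 * Real.cos (Real.pi * (β 1 / a 1)))) * hcc (c 1)
  have e2 : (z * σ' (singular a b₀ b 0) * (w * σ' (singular a b₀ b 1))).1.trace =
      (ρ (singular a b₀ b 0) * ρ (singular a b₀ b 1)).1.trace := by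
    rw [mul_assoc, ← mul_assoc (σ' _) w, Subgroup.mem_center_iff.1 hw, mul_assoc w, hzt, hwt, t2,
      ht, ← Complex.ofReal_mul, ← Complex.ofReal_mul]
    congr 1
    linear_combination (e * f * (-(2 * Real.cos (Real.pi * (β 2 / a 2))))) *
      ((-1) ^ c 1 * (-1) ^ c 1 * hcc (c 0) + hcc (c 1))
  have hk : fricke (ρ (singular a b₀ b 0)).1.trace (ρ (singular a b₀ b 1)).1.trace
      (ρ (singular a b₀ b 0) * ρ (singular a b₀ b 1)).1.trace ≠ 0 := by
    rw [hx, hy, ht, ← ofReal_fricke]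
    exact_mod_cast hfr.ne'
  obtain ⟨P, h0, h1⟩ := exists_conj_of_trace_eq (not_hasCommonEigenvector_of_irreducible hρ)
    (not_hasCommonEigenvector_of_fricke_ne_zero (X := z * σ' (singular a b₀ b 0))
      (Y := w * σ' (singular a b₀ b 1)) (by rwa [e0, e1, e2])) e0 e1 e2
  have hfib : ρ (fiber a b₀ b) ∈ Subgroup.center SL2C := map_fiber_mem_center hρ
  have hconj : (MulAut.conj P).toMonoidHom.comp ρ = σ' := by
    refine seifertGroup_hom_eq_of_center hb _ _ ?_ ?_ ?_
    · change P * ρ (fiber a b₀ b) * P⁻¹ * _ ∈ _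
      rw [Subgroup.mem_center_iff.1 hfib P, mul_inv_cancel_right, hσ', complexify_fiber hθ]
      exact mul_mem hfib (inv_mem (neg_one_zpow_mem_center k))
    · change P * ρ (singular a b₀ b 0) * P⁻¹ * _ ∈ _
      rw [← h0, mul_inv_cancel_right]
      exact hz
    · change P * ρ (singular a b₀ b 1) * P⁻¹ * _ ∈ _
      rw [← h1, mul_inv_cancel_right]
      exact hw
  exact ⟨P, fun g => (DFunLike.congr_fun hconj g).symm⟩

theorem RepConj.trace_eq {G : Type*} [Group G] {ρ ρ' : G →* SL2C} (h : RepConj ρ ρ') (g : G) :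
    (ρ' g).1.trace = (ρ g).1.trace := by
  obtain ⟨P, hP⟩ := h
  rw [hP, Matrix.SpecialLinearGroup.coe_mul, Matrix.trace_mul_comm,
    ← Matrix.SpecialLinearGroup.coe_mul, ← mul_assoc, inv_mul_cancel, one_mul]

/-- The Euler class of an induced representation is determined by the characters. -/
theorem eulerClass_eq_of_repConj (ha : ∀ i, 0 < a i)
    (hb : (a 0 : ℤ) * a 1 * a 2 * b₀ + b 0 * (a 1 * a 2) + b 1 * (a 0 * a 2) + b 2 * (a 0 * a 1)
      = 1) {β β' : Fin 3 → ℤ} (hβ : ∀ i, 0 < β i) (hβ' : ∀ i, 0 < β' i)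
    (hsum : (β 0 : ℝ) / a 0 + β 1 / a 1 + β 2 / a 2 < 1)
    (hsum' : (β' 0 : ℝ) / a 0 + β' 1 / a 1 + β' 2 / a 2 < 1)
    {ρ : SeifertGroup a b₀ b →* SL2C} {σ σ' : SeifertGroup a b₀ b →* SL2R}
    (hσ : IsInducedRep (eulerClass a (-1) β) σ) (hσ' : IsInducedRep (eulerClass a (-1) β') σ')
    (h : RepConj ρ (complexify σ)) (h' : RepConj ρ (complexify σ')) : β' = β := by
  obtain ⟨θ, hθ, rfl⟩ := hσ.exists_lift hb
  obtain ⟨θ', hθ', rfl⟩ := hσ'.exists_lift hb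
  obtain ⟨c, hc, hc0⟩ := exists_lift_coefficients ha hb (-1) β
  obtain ⟨c', hc', hc0'⟩ := exists_lift_coefficients ha hb (-1) β'
  set k := eulerDegree a (eulerClass a (-1) β)
  set k' := eulerDegree a (eulerClass a (-1) β')
  have htr : ∀ g, (UnivPSL.toSL (θ' g)).1.trace = (UnivPSL.toSL (θ g)).1.trace := fun g => by
    have h1 := (h'.trace_eq g).trans (h.trace_eq g).symm
    rw [trace_complexify, trace_complexify] at h1
    exact Complex.ofReal_injective h1
  -- The trace on the fiber gives the parity of `k`. With `-1 + c 0 + c 1 + c 2 = k b₀` it makes the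
  -- number of sign changes between the two sets of angles even.
  have hkk : (-1 : ℝ) ^ k' = (-1) ^ k := by
    have h1 := htr (fiber a b₀ b)
    rw [hθ, hθ', toSL_sh, toSL_sh, ← mul_one (rotation k), ← mul_one (rotation k'),
      trace_rotation_int_mul, trace_rotation_int_mul] at h1
    refine mul_right_cancel₀ ?_ h1
    rw [Matrix.SpecialLinearGroup.coe_one, Matrix.trace_one]
    norm_num
  have hne : (-1 : ℝ) ≠ 0 := by norm_num
  have hcc : ∀ n : ℤ, (-1 : ℝ) ^ n * (-1) ^ n = 1 := fun n => by
    rcases neg_one_zpow_cases (K := ℝ) n with h | h <;> rw [h] <;> norm_num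
  have key := triangle_angles_unique (r := fun i => (β i : ℝ) / a i)
    (s := fun i => (β' i : ℝ) / a i) (e := fun i => (-1) ^ c' i * (-1) ^ c i)
    (fun i => div_pos (by exact_mod_cast hβ i) (by exact_mod_cast ha i))
    (fun i => div_pos (by exact_mod_cast hβ' i) (by exact_mod_cast ha i)) hsum hsum'
    (fun i => by rw [← zpow_add₀ hne]; exact neg_one_zpow_cases _)
    (by
      have h1 : ∀ c : Fin 3 → ℤ, (-1 : ℝ) ^ c 0 * (-1) ^ c 1 * (-1) ^ c 2 =
          -(-1) ^ (-1 + c 0 + c 1 + c 2) := fun c => by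
        rw [zpow_add₀ hne, zpow_add₀ hne, zpow_add₀ hne, zpow_neg_one]; norm_num
      have h2 := h1 c
      have h3 := h1 c'
      rw [hc0, zpow_mul] at h2
      rw [hc0', zpow_mul, hkk] at h3
      have h4 : (((-1 : ℝ) ^ k) ^ b₀) * (((-1 : ℝ) ^ k) ^ b₀) = 1 := by
        rw [← zpow_mul]; exact hcc _
      calc _ = ((-1 : ℝ) ^ c' 0 * (-1) ^ c' 1 * (-1) ^ c' 2) *
            ((-1) ^ c 0 * (-1) ^ c 1 * (-1) ^ c 2) := by ring
        _ = 1 := by rw [h2, h3, neg_mul_neg, h4])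
    (fun i => by
      have h1 := htr (singular a b₀ b i)
      rw [trace_lift_singular ha hθ hc, trace_lift_singular ha hθ' hc'] at h1
      linear_combination (1 / 2 : ℝ) * (-1) ^ c' i * h1 -
        Real.cos (Real.pi * ((β' i : ℝ) / a i)) * hcc (c' i))
  ext i
  have hai : (a i : ℝ) ≠ 0 := by exact_mod_cast (ha i).ne'
  have h1 : (β' i : ℝ) / a i = β i / a i := congrFun key i
  have h2 : (β' i : ℝ) = β i := by field_simp at h1; exact h1
  exact_mod_cast h2

/-- The traces of an irreducible representation. -/
theorem exists_traces_of_irreducible (ha : ∀ i, 0 < a i) {ρ : SeifertGroup a b₀ b →* SL2C}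
    (hρ : (linearRep ρ).IsIrreducible) :
    ∃ n : Fin 3 → ℤ, (∀ i, 0 < n i ∧ n i < a i) ∧
      (ρ (singular a b₀ b 0)).1.trace = ((2 * Real.cos (Real.pi * (n 0 / a 0)) : ℝ) : ℂ) ∧
      (ρ (singular a b₀ b 1)).1.trace = ((2 * Real.cos (Real.pi * (n 1 / a 1)) : ℝ) : ℂ) ∧
      (ρ (singular a b₀ b 0) * ρ (singular a b₀ b 1)).1.trace =
        ((-(2 * Real.cos (Real.pi * (n 2 / a 2))) : ℝ) : ℂ) := by
  have hpow : ∀ i, ρ (singular a b₀ b i) ^ (2 * a i) = 1 := fun i => by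
    rw [mul_comm, pow_mul, ← map_pow, singular_pow, map_zpow]
    exact sq_eq_one_of_mem_center (zpow_mem (map_fiber_mem_center hρ) _)
  choose m hm0 hm1 hm using fun i =>
    exists_trace_eq_cos (ha i) (hpow i) (map_singular_not_mem_center hρ i)
  have hprod : ρ (singular a b₀ b 0) * ρ (singular a b₀ b 1) * ρ (singular a b₀ b 2) ∈
      Subgroup.center SL2C := by
    rw [← map_mul, ← map_mul, singular_prod, map_zpow]
    exact zpow_mem (map_fiber_mem_center hρ) _
  have ha2 : (a 2 : ℝ) ≠ 0 := by exact_mod_cast (ha 2).ne'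
  rcases trace_eq_of_mul_mem_center ((mem_center_sl2 _).1 hprod) with ⟨-, h⟩ | ⟨-, h⟩
  -- If the product of the images of `x`, `y`, `z` is `1` rather than `-1`, the third angle is
  -- replaced by its supplement to restore the minus sign.
  · refine ⟨![m 0, m 1, a 2 - m 2], fun i => ?_, hm 0, hm 1, ?_⟩
    · have h0 := hm0 i
      have h1 := hm1 i
      fin_cases i
      · exact ⟨h0, h1⟩
      · exact ⟨h0, h1⟩
      · simp at h0 h1 ⊢
        omega
    · rw [h, hm 2]
      simp only [Matrix.cons_val]
      congr 1
      rw [show Real.pi * (((a 2 - m 2 : ℤ) : ℝ) / a 2) = Real.pi - Real.pi * (m 2 / a 2) by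
        push_cast; field_simp, Real.cos_pi_sub]
      ring
  · refine ⟨m, fun i => ⟨hm0 i, hm1 i⟩, hm 0, hm 1, ?_⟩
    rw [h, hm 2, Complex.ofReal_neg]

/-- The subgroup `SU(2)` of `SL(2; ℂ)`. -/
def specialUnitarySubgroup : Subgroup SL2C where
  carrier := {A | A.1 ∈ Matrix.specialUnitaryGroup (Fin 2) ℂ}
  one_mem' := one_mem (Matrix.specialUnitaryGroup (Fin 2) ℂ)
  mul_mem' := fun {A B} hA hB => by
    change (A * B).1 ∈ Matrix.specialUnitaryGroup (Fin 2) ℂ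
    rw [Matrix.SpecialLinearGroup.coe_mul]
    exact (Matrix.specialUnitaryGroup (Fin 2) ℂ).mul_mem hA hB
  inv_mem' := fun {A} h => by
    change (A⁻¹).1 ∈ Matrix.specialUnitaryGroup (Fin 2) ℂ
    have h' : A.1 ∈ Matrix.unitaryGroup (Fin 2) ℂ := (Matrix.mem_specialUnitaryGroup_iff.1 h).1
    have h1 : A.1 * star A.1 = 1 := Matrix.mem_unitaryGroup_iff.1 h'
    have h3 : (A⁻¹).1 * A.1 = 1 := by
      rw [← Matrix.SpecialLinearGroup.coe_mul, inv_mul_cancel, Matrix.SpecialLinearGroup.coe_one]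
    rw [Matrix.mem_specialUnitaryGroup_iff, left_inv_eq_right_inv h3 h1]
    exact ⟨Unitary.star_mem h', by rw [← left_inv_eq_right_inv h3 h1]; exact (A⁻¹).2⟩

/-- Irreducibility makes the real Fricke polynomial nonzero. Its negative sign would give an
`SU(2)`-representation, so it is positive and the angles become those of a hyperbolic triangle after
flipping none or two of them. -/
theorem exists_eulerClass_of_irreducible (ha : ∀ i, 0 < a i)
    (hb : (a 0 : ℤ) * a 1 * a 2 * b₀ + b 0 * (a 1 * a 2) + b 1 * (a 0 * a 2) + b 2 * (a 0 * a 1)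
      = 1) {ρ : SeifertGroup a b₀ b →* SL2C} (hρ : (linearRep ρ).IsIrreducible)
    (hSU : ¬ ∃ ρ' : SeifertGroup a b₀ b →* SL2C, IsSU2Rep ρ' ∧ RepConj ρ ρ') :
    ∃ β : Fin 3 → ℤ, (∀ i, 0 < β i ∧ β i < a i) ∧
      (β 0 : ℝ) / a 0 + β 1 / a 1 + β 2 / a 2 < 1 ∧
      ∃ σ : SeifertGroup a b₀ b →* SL2R, IsInducedRep (eulerClass a (-1) β) σ ∧
        RepConj ρ (complexify σ) := by
  obtain ⟨n, hn, hx, hy, ht⟩ := exists_traces_of_irreducible ha hρ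
  have hπ := Real.pi_pos
  have haR : ∀ i, (0 : ℝ) < a i := fun i => by exact_mod_cast ha i
  have hr0 : ∀ i, (0 : ℝ) < n i / a i := fun i =>
    div_pos (by exact_mod_cast (hn i).1) (haR i)
  have hr1 : ∀ i, (n i : ℝ) / a i < 1 := fun i => by
    rw [div_lt_one (haR i)]; exact_mod_cast (hn i).2
  have hA0 : ∀ i, 0 < Real.pi * ((n i : ℝ) / a i) := fun i => mul_pos hπ (hr0 i)
  have hA1 : ∀ i, Real.pi * ((n i : ℝ) / a i) < Real.pi := fun i => by
    nlinarith [hr1 i]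
  have hsin : Real.sin (Real.pi * ((n 0 : ℝ) / a 0)) ≠ 0 :=
    (Real.sin_pos_of_pos_of_lt_pi (hA0 0) (hA1 0)).ne'
  have hne : fricke (2 * Real.cos (Real.pi * ((n 0 : ℝ) / a 0)))
      (2 * Real.cos (Real.pi * ((n 1 : ℝ) / a 1)))
      (-(2 * Real.cos (Real.pi * ((n 2 : ℝ) / a 2)))) ≠ 0 := by
    have him : ∀ C S : ℝ, ((2 * C : ℝ) : ℂ) - (C + S * Complex.I) = C + S * Complex.I →
        S = 0 := fun C S h => by
      have := congrArg Complex.im h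
      simp at this
      linarith
    have hcs : (Real.cos (Real.pi * (n 0 / a 0)) : ℂ) ^ 2 +
        (Real.sin (Real.pi * (n 0 / a 0)) : ℂ) ^ 2 = 1 := by
      exact_mod_cast Real.cos_sq_add_sin_sq _
    have h1 := fricke_ne_zero_of_not_hasCommonEigenvector
      (not_hasCommonEigenvector_of_irreducible hρ)
      (l := Real.cos (Real.pi * (n 0 / a 0)) + Real.sin (Real.pi * (n 0 / a 0)) * Complex.I)
      (by
        rw [hx, Complex.ofReal_mul, Complex.ofReal_ofNat]
        linear_combination hcs - (Real.sin (Real.pi * (n 0 / a 0)) : ℂ) ^ 2 * Complex.I_sq)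
      (by
        rw [hx]
        exact fun h => hsin (him _ _ h))
    rw [hx, hy, ht, ← ofReal_fricke] at h1
    exact_mod_cast h1
  rcases lt_or_gt_of_ne hne with hneg | hpos
  · exfalso
    obtain ⟨P, h0, h1⟩ := exists_conj_specialUnitary hsin hx hy ht hneg
    refine hSU ⟨(MulAut.conj P).toMonoidHom.comp ρ, ?_, P, fun g => rfl⟩
    have htop := subgroup_eq_top_of_pair
      (specialUnitarySubgroup.comap ((MulAut.conj P).toMonoidHom.comp ρ)) (by
        change P * ρ (fiber a b₀ b) * P⁻¹ ∈ specialUnitarySubgroup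
        have hc := map_fiber_mem_center hρ
        rw [Subgroup.mem_center_iff.1 hc P, mul_inv_cancel_right]
        change (ρ (fiber a b₀ b)).1 ∈ Matrix.specialUnitaryGroup (Fin 2) ℂ
        rw [Matrix.mem_specialUnitaryGroup_iff, Matrix.mem_unitaryGroup_iff]
        refine ⟨?_, (ρ (fiber a b₀ b)).2⟩
        rcases (mem_center_sl2 _).1 hc with h | h <;> rw [h] <;> simp)
      h0 (Or.inl h1)
    exact fun g => (htop ▸ Subgroup.mem_top g :
      g ∈ specialUnitarySubgroup.comap ((MulAut.conj P).toMonoidHom.comp ρ))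
  · have hflip : ∀ i, Real.cos (Real.pi * (((a i - n i : ℤ) : ℝ) / a i)) =
        -Real.cos (Real.pi * (n i / a i)) := fun i => by
      rw [← Real.cos_pi_sub]
      congr 1
      have := (haR i).ne'
      push_cast; field_simp
    have hdiv : ∀ i, (((a i - n i : ℤ) : ℝ) / a i) = 1 - n i / a i := fun i => by
      have := (haR i).ne'
      push_cast; field_simp
    have hn' : ∀ i, 0 < a i - n i ∧ a i - n i < a i := fun i => by
      have := hn i
      omega
    -- `e` and `f` record which of the first two angles are flipped. The third sign is `e * f`
    -- because the number of flips is even.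
    have finish : ∀ (β : Fin 3 → ℤ) (e f : ℝ), (∀ i, 0 < β i ∧ β i < a i) →
        (β 0 : ℝ) / a 0 + β 1 / a 1 + β 2 / a 2 < 1 → (e = 1 ∨ e = -1) → (f = 1 ∨ f = -1) →
        Real.cos (Real.pi * (n 0 / a 0)) = e * Real.cos (Real.pi * (β 0 / a 0)) →
        Real.cos (Real.pi * (n 1 / a 1)) = f * Real.cos (Real.pi * (β 1 / a 1)) →
        Real.cos (Real.pi * (n 2 / a 2)) = e * f * Real.cos (Real.pi * (β 2 / a 2)) →
        ∃ β : Fin 3 → ℤ, (∀ i, 0 < β i ∧ β i < a i) ∧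
          (β 0 : ℝ) / a 0 + β 1 / a 1 + β 2 / a 2 < 1 ∧
          ∃ σ : SeifertGroup a b₀ b →* SL2R, IsInducedRep (eulerClass a (-1) β) σ ∧
            RepConj ρ (complexify σ) := by
      intro β e f hβ hs he hf h0 h1 h2
      refine ⟨β, hβ, hs, exists_isInducedRep_of_trace_eq ha hb (fun i => (hβ i).1) hs hρ he hf
        ?_ ?_ ?_⟩
      · rw [hx, h0]; congr 1; ring
      · rw [hy, h1]; congr 1; ring
      · rw [ht, h2]; congr 1; ring
    have scale : ∀ {u : ℝ}, Real.pi * u < Real.pi ↔ u < 1 := fun {u} =>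
      mul_lt_iff_lt_one_right hπ
    rcases triangle_cases_of_fricke_pos (hA0 0) (hA1 0) (hA0 1) (hA1 1) (hA0 2) (hA1 2) hpos with
      h | h | h | h
    · rw [← mul_add, ← mul_add, scale] at h
      exact finish n 1 1 hn h (Or.inl rfl) (Or.inl rfl) (by ring) (by ring) (by ring)
    · refine finish ![a 0 - n 0, a 1 - n 1, n 2] (-1) (-1) ?_ ?_ (Or.inr rfl) (Or.inr rfl) ?_ ?_ ?_
      · intro i; fin_cases i
        exacts [hn' 0, hn' 1, hn 2]
      · simp only [Matrix.cons_val, hdiv]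
        rw [← scale]; linarith
      · simp only [Matrix.cons_val, hflip]; ring
      · simp only [Matrix.cons_val, hflip]; ring
      · simp only [Matrix.cons_val]; ring
    · refine finish ![a 0 - n 0, n 1, a 2 - n 2] (-1) 1 ?_ ?_ (Or.inr rfl) (Or.inl rfl) ?_ ?_ ?_
      · intro i; fin_cases i
        exacts [hn' 0, hn 1, hn' 2]
      · simp only [Matrix.cons_val, hdiv]
        rw [← scale]; linarith
      · simp only [Matrix.cons_val, hflip]; ring
      · simp only [Matrix.cons_val]; ring
      · simp only [Matrix.cons_val, hflip]; ring
    · refine finish ![n 0, a 1 - n 1, a 2 - n 2] 1 (-1) ?_ ?_ (Or.inl rfl) (Or.inr rfl) ?_ ?_ ?_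
      · intro i; fin_cases i
        exacts [hn 0, hn' 1, hn' 2]
      · simp only [Matrix.cons_val, hdiv]
        rw [← scale]; linarith
      · simp only [Matrix.cons_val]; ring
      · simp only [Matrix.cons_val, hflip]; ring
      · simp only [Matrix.cons_val, hflip]; ring

end Classes

end Brieskorn

/-! ### The classification theorem. -/

theorem mainTheorem1 (a : Fin 3 → ℕ) (ha : ∀ i, 0 < a i)
    (hcop : ∀ i j, i ≠ j → Nat.Coprime (a i) (a j)) (b₀ : ℤ) (b : Fin 3 → ℤ)
    (hb : (∏ i, (a i : ℚ)) * ((b₀ : ℚ) + ∑ i, (b i : ℚ) / (a i : ℚ)) = 1) :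
    -- every class in `E` induces a representation, which is well defined up to conjugacy
    (∀ eu ∈ Brieskorn.eulerSet a,
      (∃ σ : Brieskorn.SeifertGroup a b₀ b →* Brieskorn.SL2R, Brieskorn.IsInducedRep eu σ) ∧
      ∀ σ σ' : Brieskorn.SeifertGroup a b₀ b →* Brieskorn.SL2R,
        Brieskorn.IsInducedRep eu σ → Brieskorn.IsInducedRep eu σ' →
        Brieskorn.RepConj (Brieskorn.complexify σ) (Brieskorn.complexify σ')) ∧
    -- the main assertion
    ∀ ρ : Brieskorn.SeifertGroup a b₀ b →* Brieskorn.SL2C,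
      (Brieskorn.linearRep ρ).IsIrreducible →
      (¬ ∃ ρ' : Brieskorn.SeifertGroup a b₀ b →* Brieskorn.SL2C,
        Brieskorn.IsSU2Rep ρ' ∧ Brieskorn.RepConj ρ ρ') →
      ∃! eu : Brieskorn.EulerGroup a, eu ∈ Brieskorn.eulerSet a ∧
        ∃ σ : Brieskorn.SeifertGroup a b₀ b →* Brieskorn.SL2R,
          Brieskorn.IsInducedRep eu σ ∧ Brieskorn.RepConj ρ (Brieskorn.complexify σ) := by
  have hb' := Brieskorn.homology_sphere_int ha hb
  refine ⟨?_, fun ρ hρ hSU => ?_⟩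
  · rintro _ ⟨β, hβ, hsum, rfl⟩
    rw [Brieskorn.sum_div_lt_one_iff] at hsum
    exact ⟨Brieskorn.exists_isInducedRep ha hb' (fun i => (hβ i).1) hsum,
      fun σ σ' hσ hσ' => hσ.repConj ha hb' (fun i => (hβ i).1) hsum hσ'⟩
  · obtain ⟨β, hβ, hsum, σ, hσ, hρσ⟩ :=
      Brieskorn.exists_eulerClass_of_irreducible ha hb' hρ hSU
    refine ⟨Brieskorn.eulerClass a (-1) β,
      ⟨⟨β, hβ, Brieskorn.sum_div_lt_one_iff.2 hsum, rfl⟩, σ, hσ, hρσ⟩, ?_⟩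
    rintro _ ⟨⟨β', hβ', hsum', rfl⟩, σ', hσ', hρσ'⟩
    rw [Brieskorn.sum_div_lt_one_iff] at hsum'
    rw [Brieskorn.eulerClass_eq_of_repConj ha hb' (fun i => (hβ i).1) (fun i => (hβ' i).1)
      hsum hsum' hσ hσ' hρσ hρσ']
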